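/- Let $P$ be a fixed simple polygon in the plane $\mathbb{R}^2$ (the closed region bounded by a simple closed polygonal curve) all of whose vertices have integer coordinates, and let $\mathcal{F}=\{t+P : t\in\mathbb{R}^2\}$ be the family of all its translates. A finite hypergraph $H=(V,E)$ is representable by $\mathcal{F}$ if there are points $p_v\in\mathbb{R}^2$ for $v\in V$ and sets $s_e\in\mathcal{F}$ for $e\in E$ such that, for every $e \in E$, the set $s_e$ contains exactly the points of $e$ among the points of all vertices, that is, $p_v\in s_e \iff v\in e$ for all $v\in V$ and $e\in E$. Then the problem $\textsc{Recognition}(\mathcal{F})$ of deciding, for a given finite hypergraph $H$ (encoded as a word by the number of its vertices in unary and the incidence vectors of its hyperedges), whether $H$ is representable by $\mathcal{F}$ is contained in $\mathsf{NP}$. -/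

import Mathlib

open Computability

/-! ### The class NP -/

/-- The word `x # y` over the disjoint union of the two alphabets and a separator `# = none`. -/
def pairWord {Γ Δ : Type} (q : List Γ × List Δ) : List (Option (Γ ⊕ Δ)) :=
  q.1.map (fun a => some (Sum.inl a)) ++ none :: q.2.map (fun b => some (Sum.inr b))

/-- A language `L` over `Γ` belongs to NP: there are a finite alphabet `Δ` of certificates, a
checking relation `V` decided by a Turing machine in time polynomial in the length of `x # y`, and
a polynomial `p`, such that `x ∈ L` iff some `y` with `|y| ≤ p(|x|)` satisfies `V (x, y)`. -/
def InNP {Γ : Type} (L : Language Γ) : Prop :=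
  ∃ (Δ : Type) (_ : Finite Δ) (V : List Γ × List Δ → Bool) (p : Polynomial ℕ),
    Nonempty (Turing.TM2ComputableInPolyTime pairWord encodeBool V) ∧
      ∀ x : List Γ, x ∈ L ↔ ∃ y : List Δ, y.length ≤ p.eval x.length ∧ V (x, y) = true

/-! ### Geometric representations of hypergraphs -/

namespace Hypergraph

/-- Points `p v` for the vertices and connected sets `s e` for the hyperedges form a geometric
representation of `H`: the set `s e` contains, among the points of all vertices, exactly the points
of the vertices in `e`. -/
def IsGeometricRepresentation {α X : Type*} [TopologicalSpace X] (H : Hypergraph α)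
    (p : α → X) (s : Set α → Set X) : Prop :=
  ∀ e ∈ H.edgeSet, IsConnected (s e) ∧ ∀ v ∈ H.vertexSet, p v ∈ s e ↔ v ∈ e

/-- For pairwise distinct points this is the equation
`{p v | v ∈ V} ∩ s e = {p v | v ∈ e}` for all hyperedges `e`. -/
theorem isGeometricRepresentation_iff_of_injOn {α X : Type*} [TopologicalSpace X]
    {H : Hypergraph α} {p : α → X} (s : Set α → Set X) (hp : Set.InjOn p H.vertexSet) :
    H.IsGeometricRepresentation p s ↔
      ∀ e ∈ H.edgeSet, IsConnected (s e) ∧ p '' H.vertexSet ∩ s e = p '' e := by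
  refine forall₂_congr fun e he => and_congr_right fun _ => ?_
  have hsub : e ⊆ H.vertexSet := H.subset_vertexSet_of_mem_edgeSet' he
  constructor
  · intro h
    ext x
    constructor
    · rintro ⟨⟨v, hv, rfl⟩, hx⟩
      exact ⟨v, (h v hv).1 hx, rfl⟩
    · rintro ⟨v, hv, rfl⟩
      exact ⟨⟨v, hsub hv, rfl⟩, (h v (hsub hv)).2 hv⟩
  · intro h v hv
    constructor
    · intro hx
      have hmem : p v ∈ p '' e := h ▸ ⟨⟨v, hv, rfl⟩, hx⟩
      obtain ⟨u, hu, huv⟩ := hmem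
      exact hp (hsub hu) hv huv ▸ hu
    · intro hve
      have hmem : p v ∈ p '' H.vertexSet ∩ s e := h.symm ▸ ⟨v, hve, rfl⟩
      exact hmem.2

/-- `H` is representable by the family `F`: it has a geometric representation in which the sets of
all hyperedges belong to `F`. -/
def IsRepresentableBy {α X : Type*} [TopologicalSpace X] (H : Hypergraph α)
    (F : Set (Set X)) : Prop :=
  ∃ (p : α → X) (s : Set α → Set X),
    (∀ e ∈ H.edgeSet, s e ∈ F) ∧ H.IsGeometricRepresentation p s

/-- The finite hypergraph on the vertices `0, …, n - 1` whose hyperedges are given by a list of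
incidence vectors. -/
def ofIncidence {n : ℕ} (rows : List (Fin n → Bool)) : Hypergraph (Fin n) where
  vertexSet := Set.univ
  edgeSet := {e | ∃ r ∈ rows, e = {v | r v = true}}
  subset_vertexSet_of_mem_edgeSet' := fun _ _ => Set.subset_univ _

/-- The word `1ⁿ # r₁ # r₂ ⋯ # rₘ` over `{0, 1, #}` with `# = none` that lists the number of
vertices in unary and the incidence vectors of the hyperedges. -/
def encodeIncidence {n : ℕ} (rows : List (Fin n → Bool)) : List (Option Bool) :=
  List.replicate n (some true) ++ rows.flatMap (fun r => none :: (List.ofFn r).map some)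

end Hypergraph

/-- The decision problem `RECOGNITION(F)`: the words that encode a finite hypergraph which is
representable by the family `F`. -/
def Recognition {X : Type*} [TopologicalSpace X] (F : Set (Set X)) : Language (Option Bool) :=
  {w | ∃ (n : ℕ) (rows : List (Fin n → Bool)),
    w = Hypergraph.encodeIncidence rows ∧ (Hypergraph.ofIncidence rows).IsRepresentableBy F}

/-- The family of all translates of a set. -/
def translates {E : Type*} [Add E] (K : Set E) : Set (Set E) :=
  Set.range fun t : E => (fun x => t + x) '' K

/-! ### Simple polygons in the plane -/

namespace Polygon

/-- A polygon is simple if its closed boundary curve, traversed once along the edges (each taken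
without its end point), visits no point twice. -/
def IsSimple {n : ℕ} (P : Polygon (EuclideanSpace ℝ (Fin 2)) n) : Prop :=
  3 ≤ n ∧ ∀ i j : Fin n, ∀ s ∈ Set.Ico (0 : ℝ) 1, ∀ t ∈ Set.Ico (0 : ℝ) 1,
    P.edgePath ℝ i s = P.edgePath ℝ j t → i = j ∧ s = t

/-- All vertices have integer coordinates. -/
def HasIntegerCoordinates {n : ℕ} (P : Polygon (EuclideanSpace ℝ (Fin 2)) n) : Prop :=
  ∀ (i : Fin n) (k : Fin 2), ∃ z : ℤ, P i k = (z : ℝ)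

/-- The closed region of the plane enclosed by a polygon: its boundary together with the bounded
connected components of the complement of the boundary. -/
def region {n : ℕ} (P : Polygon (EuclideanSpace ℝ (Fin 2)) n) :
    Set (EuclideanSpace ℝ (Fin 2)) :=
  P.boundary ℝ ∪
    {x | x ∉ P.boundary ℝ ∧ Bornology.IsBounded (connectedComponentIn (P.boundary ℝ)ᶜ x)}

end Polygon

/-!
Recognition of hypergraphs that are represented by translates of a polygon `P` with integer vertices
is in NP because representable hypergraphs have representations with rational coordinates of
polynomial bit length, and because such a representation can be verified by a machine that only
compares letters at a few fixed distances.

*Signs.* Whether a point lies in the region of `P` depends only on the signs at this point of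
finitely many integer affine forms (`Polygon.exists_forms_region`). The region is connected
(`Polygon.isConnected_region`), so that its translates are admissible, and representability says
that there are points `p v` and translation vectors `t e` such that `p v - t e` lies in the region
iff `v ∈ e` (`Hypergraph.isRepresentableBy_translates_iff`).

*Small solutions.* With a common denominator `d` as a further unknown, the sign conditions on the
differences `p v - t e` become homogeneous linear conditions with coefficients from a fixed finite
set. A real solution yields a basic solution, in which the tight constraints determine the point,
and Cramer's rule bounds its numerators and denominator by determinants (`exists_nat_sign_eq`). So
the coordinates are integers with polynomially many binary digits.

*Certificates.* The sign of a fixed integer linear form of natural numbers is computed by a finite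
automaton that reads all binary digits in parallel, the most significant one first: the automaton
remembers the value of the form on the prefixes, truncated to a bounded interval
(`sign_runStreams_signStep`). The certificate is a sequence of slices of the shape of the input
word, one per digit. Each slice records at the position of the pair `(v, e)` the current digits of
`p v`, `t e` and `d` and the state of the automaton for this pair. That the digits agree within the
columns and rows, and that each slice follows from the previous one, are conditions on letters at
the distances `1`, `n + 1` and `|x| + 1`, where `n` is the number of vertices and `x` is the input
(`Cell.valid_ofStreams`, `Cell.exists_streams_of_valid`, `inNP_of_streams`). A machine with four
work stacks checks such conditions in linear time: it makes three copies of the word, shifts two of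
them, and compares (`WindowCheck.nonempty_computableInPolyTime`).
-/

/-! ### A linear-time Turing machine for window checks -/

namespace WindowCheck

open Turing StateTransition

/-- The stack alphabets of the machine: four work stacks over `S` and the output stack. -/
abbrev StackAlphabet (S : Type) : Option (Fin 4) → Type
  | none => Bool
  | some _ => S

/-- The internal state of the machine: a verdict and the four symbols of the current window. -/
abbrev State (S : Type) : Type := Bool × Option S × Option S × Option S × Option S

variable {S : Type}

/-- Slides a window along the word `b`, together with the heads of two further words that advance
at the same speed, and tests every window by `R`. -/
def scan (R : Option S → Option S → Option S → Option S → Bool) :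
    List S → List S → List S → Bool
  | [], _, _ => true
  | s :: b, c, d => R (some s) b.head? c.head? d.head? && scan R b c.tail d.tail

/-- The window check that the machine performs on the word `w`: the window at position `i` shows
the letters at the positions `i`, `i + 1`, `i + k` and `i + l`, where `k - 1` and `l - 1` are the
positions of the first letter that fails `one` and of the first letter that satisfies `sep`. -/
def check (one sep : S → Bool) (R : Option S → Option S → Option S → Option S → Bool)
    (w : List S) : Bool :=
  scan R w (w.dropWhile one).tail (w.dropWhile fun s => !sep s).tail

/-- The program. The labels `0` and `1` make three copies of the input, `2` and `3` shift two of
them, `4` compares, and `5` writes the verdict. -/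
def program [Inhabited S] (one sep : S → Bool)
    (R : Option S → Option S → Option S → Option S → Bool) :
    Fin 6 → TM2.Stmt (StackAlphabet S) (Fin 6) (State S)
  | 0 => .pop (some 0) (fun v a => (v.1, a, none, none, none)) <|
      .branch (fun v => v.2.1.isSome)
        (.push (some 1) (fun v => v.2.1.getD default) <| .goto fun _ => 0)
        (.goto fun _ => 1)
  | 1 => .pop (some 1) (fun v a => (v.1, a, none, none, none)) <|
      .branch (fun v => v.2.1.isSome)
        (.push (some 0) (fun v => v.2.1.getD default) <|
          .push (some 2) (fun v => v.2.1.getD default) <|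
          .push (some 3) (fun v => v.2.1.getD default) <| .goto fun _ => 1)
        (.goto fun _ => 2)
  | 2 => .pop (some 2) (fun v a => (v.1, a, none, none, none)) <|
      .branch (fun v => v.2.1.any one) (.goto fun _ => 2) (.goto fun _ => 3)
  | 3 => .pop (some 3) (fun v a => (v.1, a, none, none, none)) <|
      .branch (fun v => v.2.1.any fun s => !sep s) (.goto fun _ => 3) (.goto fun _ => 4)
  | 4 => .pop (some 0) (fun v a => (v.1, a, none, none, none)) <|
      .peek (some 0) (fun v a => (v.1, v.2.1, a, none, none)) <|
      .pop (some 2) (fun v a => (v.1, v.2.1, v.2.2.1, a, none)) <|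
      .pop (some 3) (fun v a => (v.1, v.2.1, v.2.2.1, v.2.2.2.1, a)) <|
      .branch (fun v => v.2.1.isSome)
        (.load (fun v => (v.1 && R v.2.1 v.2.2.1 v.2.2.2.1 v.2.2.2.2, v.2)) <| .goto fun _ => 4)
        (.goto fun _ => 5)
  | 5 => .push none (fun v => v.1) <| .load (fun _ => (true, none, none, none, none)) .halt

/-- The machine that performs the window check. -/
def machine [Inhabited S] [Fintype S] (one sep : S → Bool)
    (R : Option S → Option S → Option S → Option S → Bool) : FinTM2 where
  K := Option (Fin 4)
  k₀ := some 0
  k₁ := none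
  Γ := StackAlphabet S
  Λ := Fin 6
  main := 0
  σ := State S
  initialState := (true, none, none, none, none)
  Γk₀Fin := inferInstanceAs (Fintype S)
  m := program one sep R

/-- The stack contents with `a`, `b`, `c`, `d` on the work stacks and `o` on the output stack. -/
def stackContents (a b c d : List S) (o : List Bool) : ∀ k, List (StackAlphabet S k)
  | none => o
  | some 0 => a
  | some 1 => b
  | some 2 => c
  | some 3 => d

section Stacks

variable (a b c d e : List S) (o o' : List Bool)

@[simp] lemma update_stackContents_zero :
    Function.update (stackContents a b c d o) (some 0) e = stackContents e b c d o := by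
  funext k; rcases k with _ | k
  · rfl
  · fin_cases k <;> rfl

@[simp] lemma update_stackContents_one :
    Function.update (stackContents a b c d o) (some 1) e = stackContents a e c d o := by
  funext k; rcases k with _ | k
  · rfl
  · fin_cases k <;> rfl

@[simp] lemma update_stackContents_two :
    Function.update (stackContents a b c d o) (some 2) e = stackContents a b e d o := by
  funext k; rcases k with _ | k
  · rfl
  · fin_cases k <;> rfl

@[simp] lemma update_stackContents_three :
    Function.update (stackContents a b c d o) (some 3) e = stackContents a b c e o := by
  funext k; rcases k with _ | k
  · rfl
  · fin_cases k <;> rfl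

@[simp] lemma update_stackContents_none :
    Function.update (stackContents a b c d o) none o' = stackContents a b c d o' := by
  funext k; rcases k with _ | k
  · rfl
  · fin_cases k <;> rfl

end Stacks

section runs

variable [Inhabited S] (one sep : S → Bool)
  (R : Option S → Option S → Option S → Option S → Bool)

/-- The program runs from the configuration `c` to the configuration `c'` in at most `t` steps. -/
def Runs (c c' : TM2.Cfg (StackAlphabet S) (Fin 6) (State S)) (t : ℕ) : Prop :=
  Nonempty (EvalsToInTime (TM2.step (program one sep R)) c (some c') t)

variable {one sep R}

lemma Runs.single {c c' : TM2.Cfg (StackAlphabet S) (Fin 6) (State S)}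
    (h : TM2.step (program one sep R) c = some c') : Runs one sep R c c' 1 :=
  ⟨⟨⟨1, h⟩, le_rfl⟩⟩

lemma Runs.trans {c₁ c₂ c₃ : TM2.Cfg (StackAlphabet S) (Fin 6) (State S)} {t₁ t₂ t : ℕ}
    (h₁ : Runs one sep R c₁ c₂ t₁) (h₂ : Runs one sep R c₂ c₃ t₂) (ht : t₁ + t₂ ≤ t) :
    Runs one sep R c₁ c₃ t := by
  obtain ⟨h₁⟩ := h₁
  obtain ⟨h₂⟩ := h₂
  have h := EvalsToInTime.trans _ _ _ _ _ _ h₁ h₂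
  exact ⟨⟨h.toEvalsTo, h.steps_le_m.trans (by omega)⟩⟩

lemma runs_load (a b : List S) (v : State S) :
    ∃ v' : State S, v'.1 = v.1 ∧ Runs one sep R ⟨some 0, v, stackContents a b [] [] []⟩
      ⟨some 1, v', stackContents [] (a.reverse ++ b) [] [] []⟩ (a.length + 1) := by
  induction a generalizing b v with
  | nil =>
    refine ⟨(v.1, none, none, none, none), rfl, Runs.single ?_⟩
    simp [program, stackContents]
  | cons s a ih =>
    obtain ⟨v', hv', h⟩ := ih (s :: b) (v.1, some s, none, none, none)
    refine ⟨v', hv', (Runs.single ?_).trans (by simpa using h) (by simp; omega)⟩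
    simp [program, stackContents]

lemma runs_copy (a b c d : List S) (v : State S) :
    ∃ v' : State S, v'.1 = v.1 ∧ Runs one sep R ⟨some 1, v, stackContents a b c d []⟩
      ⟨some 2, v', stackContents (b.reverse ++ a) [] (b.reverse ++ c) (b.reverse ++ d) []⟩
      (b.length + 1) := by
  induction b generalizing a c d v with
  | nil =>
    refine ⟨(v.1, none, none, none, none), rfl, Runs.single ?_⟩
    simp [program, stackContents]
  | cons s b ih =>
    obtain ⟨v', hv', h⟩ := ih (s :: a) (s :: c) (s :: d) (v.1, some s, none, none, none)
    refine ⟨v', hv', (Runs.single ?_).trans (by simpa using h) (by simp; omega)⟩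
    simp [program, stackContents]

lemma runs_drop_one (a c d : List S) (v : State S) :
    ∃ v' : State S, v'.1 = v.1 ∧ Runs one sep R ⟨some 2, v, stackContents a [] c d []⟩
      ⟨some 3, v', stackContents a [] (c.dropWhile one).tail d []⟩ (c.length + 1) := by
  induction c generalizing v with
  | nil =>
    refine ⟨(v.1, none, none, none, none), rfl, Runs.single ?_⟩
    simp [program, stackContents]
  | cons s c ih =>
    by_cases hs : one s = true
    · obtain ⟨v', hv', h⟩ := ih (v.1, some s, none, none, none)
      refine ⟨v', hv', (Runs.single ?_).trans (by simpa [hs] using h) (by simp; omega)⟩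
      simp [program, stackContents, hs]
    · refine ⟨(v.1, some s, none, none, none), rfl,
        (Runs.single ?_).trans (t₂ := 0) ⟨EvalsToInTime.refl _ _⟩ (by simp)⟩
      simp [program, stackContents, hs]

lemma runs_drop_sep (a c d : List S) (v : State S) :
    ∃ v' : State S, v'.1 = v.1 ∧ Runs one sep R ⟨some 3, v, stackContents a [] c d []⟩
      ⟨some 4, v', stackContents a [] c (d.dropWhile fun s => !sep s).tail []⟩ (d.length + 1) := by
  induction d generalizing v with
  | nil =>
    refine ⟨(v.1, none, none, none, none), rfl, Runs.single ?_⟩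
    simp [program, stackContents]
  | cons s d ih =>
    by_cases hs : sep s = true
    · refine ⟨(v.1, some s, none, none, none), rfl,
        (Runs.single ?_).trans (t₂ := 0) ⟨EvalsToInTime.refl _ _⟩ (by simp)⟩
      simp [program, stackContents, hs]
    · obtain ⟨v', hv', h⟩ := ih (v.1, some s, none, none, none)
      refine ⟨v', hv', (Runs.single ?_).trans (by simpa [hs] using h) (by simp; omega)⟩
      simp [program, stackContents, hs]

lemma runs_scan (a c d : List S) (hc : c.length ≤ a.length) (hd : d.length ≤ a.length)
    (v : State S) :
    ∃ v' : State S, v'.1 = (v.1 && scan R a c d) ∧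
      Runs one sep R ⟨some 4, v, stackContents a [] c d []⟩ ⟨some 5, v', stackContents [] [] [] [] []⟩
        (a.length + 1) := by
  induction a generalizing c d v with
  | nil =>
    obtain rfl : c = [] := by simpa using hc
    obtain rfl : d = [] := by simpa using hd
    refine ⟨(v.1, none, none, none, none), by simp [scan], Runs.single ?_⟩
    simp [program, stackContents]
  | cons s a ih =>
    obtain ⟨v', hv', h⟩ := ih c.tail d.tail (by simp at hc ⊢; omega) (by simp at hd ⊢; omega)
      (v.1 && R (some s) a.head? c.head? d.head?, some s, a.head?, c.head?, d.head?)
    refine ⟨v', by simp [hv', scan, Bool.and_assoc], (Runs.single ?_).trans h (by simp; omega)⟩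
    simp [program, stackContents]

lemma runs_program (w : List S) :
    Runs one sep R ⟨some 0, (true, none, none, none, none), stackContents w [] [] [] []⟩
      ⟨none, (true, none, none, none, none), stackContents [] [] [] [] [check one sep R w]⟩
      (5 * w.length + 6) := by
  obtain ⟨v₁, hv₁, h₁⟩ := runs_load (one := one) (sep := sep) (R := R) w []
    (true, none, none, none, none)
  obtain ⟨v₂, hv₂, h₂⟩ := runs_copy (one := one) (sep := sep) (R := R) [] (w.reverse ++ []) [] [] v₁
  simp only [List.append_nil, List.reverse_reverse, List.length_reverse] at h₁ h₂
  obtain ⟨v₃, hv₃, h₃⟩ := runs_drop_one (one := one) (sep := sep) (R := R) w w w v₂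
  obtain ⟨v₄, hv₄, h₄⟩ := runs_drop_sep (one := one) (sep := sep) (R := R) w
    (w.dropWhile one).tail w v₃
  obtain ⟨v₅, hv₅, h₅⟩ := runs_scan (one := one) (sep := sep) (R := R) w
    (w.dropWhile one).tail (w.dropWhile fun s => !sep s).tail
    (by simpa using (Nat.sub_le _ _).trans (List.dropWhile_suffix one).length_le)
    (by simpa using (Nat.sub_le _ _).trans (List.dropWhile_suffix _).length_le) v₄
  have h₆ : Runs one sep R ⟨some 5, v₅, stackContents [] [] [] [] []⟩
      ⟨none, (true, none, none, none, none), stackContents [] [] [] [] [check one sep R w]⟩ 1 := by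
    refine Runs.single ?_
    simp [program, hv₅, hv₄, hv₃, hv₂, hv₁, check, stackContents]
  exact ((((h₁.trans h₂ le_rfl).trans h₃ le_rfl).trans h₄ le_rfl).trans h₅ le_rfl).trans h₆
    (by omega)

end runs

/-- Window checks are decided in linear time. -/
theorem nonempty_computableInPolyTime {α S : Type} [Inhabited S] [Finite S] (enc : α → List S)
    (one sep : S → Bool) (R : Option S → Option S → Option S → Option S → Bool) :
    Nonempty (TM2ComputableInPolyTime enc encodeBool fun a => check one sep R (enc a)) := by
  have := Fintype.ofFinite S
  refine ⟨⟨⟨machine one sep R, Equiv.refl S, Equiv.refl Bool⟩, 5 * Polynomial.X + 6, fun a => ?_⟩⟩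
  have h := (runs_program (one := one) (sep := sep) (R := R) (enc a)).some
  have h₀ : initList (machine one sep R) (enc a) =
      (⟨some 0, (true, none, none, none, none), stackContents (enc a) [] [] [] []⟩ :
        TM2.Cfg (StackAlphabet S) (Fin 6) (State S)) := by
    refine congrArg (TM2.Cfg.mk _ _) (funext fun k => ?_)
    rcases k with _ | k
    · rfl
    · fin_cases k <;> rfl
  have h₁ : haltList (machine one sep R) [check one sep R (enc a)] =
      (⟨none, (true, none, none, none, none),
        stackContents [] [] [] [] [check one sep R (enc a)]⟩ :
        TM2.Cfg (StackAlphabet S) (Fin 6) (State S)) := by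
    refine congrArg (TM2.Cfg.mk _ _) (funext fun k => ?_)
    rcases k with _ | k
    · rfl
    · fin_cases k <;> rfl
  have h₂ : ∀ (w : List S) (t : ℕ), w = enc a → t = 5 * (enc a).length + 6 →
      EvalsToInTime (TM2.step (program one sep R)) (initList (machine one sep R) w)
        (some (haltList (machine one sep R) [check one sep R (enc a)])) t := by
    rintro w t rfl rfl
    rw [h₀, h₁]
    exact h
  exact h₂ _ _ (List.map_id _) (by simp)

end WindowCheck

namespace WindowCheck

variable {S : Type}

/-- Past its end, a word shows the symbol `none` in the window. -/
lemma scan_iff (R : Option S → Option S → Option S → Option S → Bool) (b u v : List S) :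
    scan R b u v = true ↔ ∀ i < b.length, R b[i]? b[i + 1]? u[i]? v[i]? = true := by
  induction b generalizing u v with
  | nil => simp [scan]
  | cons s b ih =>
    rw [scan, Bool.and_eq_true, ih]
    constructor
    · rintro ⟨h₀, h⟩ (_ | i) hi
      · simpa [List.head?_eq_getElem?] using h₀
      · simpa [List.getElem?_tail] using h i (by simpa using hi)
    · intro h
      refine ⟨by simpa [List.head?_eq_getElem?] using h 0 (by simp), fun i hi => ?_⟩
      simpa [List.getElem?_tail] using h (i + 1) (by simpa using hi)

lemma getElem?_tail_dropWhile (p : S → Bool) (w : List S) (k : ℕ)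
    (h : ∀ i < k, ∃ s, w[i]? = some s ∧ p s = true) (hk : ∃ s, w[k]? = some s ∧ p s = false)
    (i : ℕ) : (w.dropWhile p).tail[i]? = w[i + (k + 1)]? := by
  induction k generalizing w with
  | zero =>
    obtain ⟨s, hs, hps⟩ := hk
    rcases w with _ | ⟨t, w⟩
    · simp at hs
    · obtain rfl : t = s := by simpa using hs
      simp [hps]
  | succ k ih =>
    obtain ⟨s, hs, hps⟩ := h 0 (by omega)
    rcases w with _ | ⟨t, w⟩
    · simp at hs
    · obtain rfl : t = s := by simpa using hs
      rw [List.dropWhile_cons_of_pos hps,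
        ih w (fun j hj => by simpa using h (j + 1) (by omega)) (by simpa using hk),
        show i + (k + 1 + 1) = i + (k + 1) + 1 by omega, List.getElem?_cons_succ]

/-- A window check inspects the letters at distance `1`, `k + 1` and `l + 1`. -/
lemma check_iff (one sep : S → Bool) (R : Option S → Option S → Option S → Option S → Bool)
    (w : List S) (k l : ℕ)
    (hk : ∀ i < k, ∃ s, w[i]? = some s ∧ one s = true) (hk' : ∃ s, w[k]? = some s ∧ one s = false)
    (hl : ∀ i < l, ∃ s, w[i]? = some s ∧ sep s = false)
    (hl' : ∃ s, w[l]? = some s ∧ sep s = true) :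
    check one sep R w = true ↔
      ∀ i < w.length, R w[i]? w[i + 1]? w[i + (k + 1)]? w[i + (l + 1)]? = true := by
  rw [check, scan_iff]
  simp only [getElem?_tail_dropWhile one w k hk hk',
    getElem?_tail_dropWhile (fun s => !sep s) w l (by simpa using hl) (by simpa using hl')]

end WindowCheck

/-! ### Words that encode hypergraphs -/

namespace Hypergraph

lemma length_flatMap_rows {n : ℕ} (rows : List (Fin n → Bool)) :
    (rows.flatMap fun r => none :: (List.ofFn r).map some).length = rows.length * (n + 1) := by
  induction rows with
  | nil => simp
  | cons r rows ih => rw [List.flatMap_cons, List.length_append, ih]; simp; ring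

lemma length_encodeIncidence {n : ℕ} (rows : List (Fin n → Bool)) :
    (encodeIncidence rows).length + 1 = (rows.length + 1) * (n + 1) := by
  rw [encodeIncidence, List.length_append, length_flatMap_rows]; simp; ring

lemma getElem?_flatMap_rows_hash {n : ℕ} (rows : List (Fin n → Bool)) (e : ℕ)
    (he : e < rows.length) :
    (rows.flatMap fun r => none :: (List.ofFn r).map some)[e * (n + 1)]? = some none := by
  induction rows generalizing e with
  | nil => simp at he
  | cons r rows ih =>
    rw [List.flatMap_cons]
    rcases e with _ | e
    · simp
    · rw [List.getElem?_append_right (by simp [add_mul])]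
      simpa [add_mul] using ih e (by simpa using he)

lemma getElem?_flatMap_rows {n : ℕ} (rows : List (Fin n → Bool)) (e : Fin rows.length)
    (v : Fin n) :
    (rows.flatMap fun r => none :: (List.ofFn r).map some)[(e : ℕ) * (n + 1) + (v + 1)]? =
      some (some (rows[e] v)) := by
  induction rows with
  | nil => exact e.elim0
  | cons r rows ih =>
    rw [List.flatMap_cons]
    obtain ⟨_ | e, he⟩ := e
    · rw [List.getElem?_append_left (by simp)]
      simp
      rfl
    · rw [List.getElem?_append_right (by simp; nlinarith)]
      have := ih ⟨e, by simpa using he⟩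
      have h : (e + 1) * (n + 1) + (v + 1 : ℕ) - (n + 1) = e * (n + 1) + (v + 1) := by
        rw [add_mul]; omega
      simpa [h] using this

lemma getElem?_encodeIncidence_header {n : ℕ} (rows : List (Fin n → Bool)) (v : ℕ) (hv : v < n) :
    (encodeIncidence rows)[v]? = some (some true) := by
  rw [encodeIncidence, List.getElem?_append_left (by simpa using hv)]
  simp [hv]

lemma getElem?_encodeIncidence_hash {n : ℕ} (rows : List (Fin n → Bool)) (e : ℕ)
    (he : e < rows.length) : (encodeIncidence rows)[e * (n + 1) + n]? = some none := by
  rw [encodeIncidence, List.getElem?_append_right (by simp)]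
  simpa using getElem?_flatMap_rows_hash rows e he

lemma getElem?_encodeIncidence_row {n : ℕ} (rows : List (Fin n → Bool)) (e : Fin rows.length)
    (v : Fin n) :
    (encodeIncidence rows)[((e : ℕ) + 1) * (n + 1) + v]? = some (some (rows[e] v)) := by
  rw [encodeIncidence, List.getElem?_append_right (by simp; nlinarith), ← getElem?_flatMap_rows]
  congr 1
  simp [add_mul]; omega

/-- The ends of the blocks of an encoding, which include the end of the word, are the positions
congruent to `n` modulo `n + 1`. -/
lemma getElem?_encodeIncidence_delimiter {n : ℕ} (rows : List (Fin n → Bool)) (k : ℕ) :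
    ((encodeIncidence rows)[k % ((encodeIncidence rows).length + 1)]? = none ∨
      (encodeIncidence rows)[k % ((encodeIncidence rows).length + 1)]? = some none) ↔
      k % (n + 1) = n := by
  have hl := length_encodeIncidence rows
  have hr := Nat.mod_lt k (Nat.succ_pos (encodeIncidence rows).length)
  rw [← Nat.mod_mod_of_dvd k (⟨rows.length + 1, by rw [hl, mul_comm]⟩ :
    n + 1 ∣ (encodeIncidence rows).length + 1)]
  generalize k % ((encodeIncidence rows).length + 1) = r at hr ⊢
  have hlt : r % (n + 1) < n + 1 := Nat.mod_lt _ (by omega)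
  have hdiv := Nat.div_add_mod' r (n + 1)
  have hq : r / (n + 1) < rows.length + 1 := by
    rw [Nat.div_lt_iff_lt_mul (by omega)]; omega
  rcases Nat.lt_succ_iff_lt_or_eq.1 hlt with h | h
  · refine iff_of_false ?_ h.ne
    rcases hq' : r / (n + 1) with _ | e
    · have : r < n := by rw [hq'] at hdiv; omega
      rw [getElem?_encodeIncidence_header rows r this]
      simp
    · rw [hq'] at hdiv hq
      have h₂ := getElem?_encodeIncidence_row rows ⟨e, by omega⟩ ⟨_, h⟩
      simp only [hdiv] at h₂
      simp [h₂]
  · refine iff_of_true ?_ h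
    rw [h] at hdiv
    by_cases he : r / (n + 1) < rows.length
    · have h₂ := getElem?_encodeIncidence_hash rows _ he
      rw [hdiv] at h₂
      exact .inr h₂
    · have : r / (n + 1) = rows.length := by omega
      rw [this] at hdiv
      rw [add_mul] at hl
      exact .inl (List.getElem?_eq_none (by omega))

/-- An encoding is determined by its length, the positions of the separators, and the letters
between them. -/
lemma eq_encodeIncidence {n : ℕ} (rows : List (Fin n → Bool)) (x : List (Option Bool))
    (hlen : x.length + 1 = (rows.length + 1) * (n + 1))
    (hheader : ∀ v < n, x[v]? = some (some true))
    (hhash : ∀ e < rows.length, x[e * (n + 1) + n]? = some none)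
    (hrow : ∀ (e : Fin rows.length) (v : Fin n),
      x[((e : ℕ) + 1) * (n + 1) + v]? = some (some (rows[e] v))) :
    x = encodeIncidence rows := by
  have hl := length_encodeIncidence rows
  refine List.ext_getElem? fun i => ?_
  by_cases hi : x.length ≤ i
  · rw [List.getElem?_eq_none hi, List.getElem?_eq_none (by omega)]
  have hlt : i % (n + 1) < n + 1 := Nat.mod_lt _ (by omega)
  have hdiv := Nat.div_add_mod' i (n + 1)
  have hq : i / (n + 1) < rows.length + 1 := by
    rw [Nat.div_lt_iff_lt_mul (by omega)]; omega
  rcases Nat.lt_succ_iff_lt_or_eq.1 hlt with h | h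
  · rcases hq' : i / (n + 1) with _ | e
    · have : i < n := by rw [hq'] at hdiv; omega
      rw [hheader i this, getElem?_encodeIncidence_header rows i this]
    · rw [hq'] at hdiv hq
      have h₁ := hrow ⟨e, by omega⟩ ⟨_, h⟩
      have h₂ := getElem?_encodeIncidence_row rows ⟨e, by omega⟩ ⟨_, h⟩
      simp only [hdiv] at h₁ h₂
      rw [h₁, h₂]
  · have he : i / (n + 1) < rows.length := by
      by_contra hcon
      have : i / (n + 1) = rows.length := by omega
      rw [this, h] at hdiv
      rw [add_mul] at hlen
      omega
    have h₁ := hhash _ he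
    have h₂ := getElem?_encodeIncidence_hash rows _ he
    rw [h] at hdiv
    rw [hdiv] at h₁ h₂
    rw [h₁, h₂]

end Hypergraph

/-! ### Certificates that list the runs of a finite automaton -/

/-- The state of an automaton after it has read the first `j` letters of a pair of streams. -/
def runStreams {A Q : Type} (q₀ : Q) (δ : Q → A → A → Q) (ξ η : ℕ → A) : ℕ → Q
  | 0 => q₀
  | j + 1 => δ (runStreams q₀ δ ξ η j) (ξ j) (η j)

/-- A certificate is a sequence of slices, each as long as the input word together with a
separator. A cell of a slice lists the input letter `src` at its position (`none` for the
separator), whether it lies in the block `header` of the unary number of vertices, the current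
letter `vtx` of the stream of its vertex (column), the current letter `edg` of the stream of its
hyperedge (row), and the state of the automaton before these two letters are read. -/
structure Cell (A Q : Type) where
  /-- The input letter at the position of the cell. -/
  src : Option (Option Bool)
  /-- Whether the cell lies in the block of the unary number of vertices. -/
  header : Bool
  /-- The current letter of the vertex stream. -/
  vtx : A
  /-- The current letter of the hyperedge stream. -/
  edg : A
  /-- The state of the automaton before the two current letters are read. -/
  state : Q

namespace Cell

variable {A Q : Type}

instance [Finite A] [Finite Q] : Finite (Cell A Q) :=
  Finite.of_injective
    (fun c : Cell A Q => (c.src, c.header, c.vtx, c.edg, c.state)) <| by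
      rintro ⟨_, _, _, _, _⟩ ⟨_, _, _, _, _⟩ h
      simpa using h

/-- The input letter that belongs to a symbol of the word `x # y`. -/
def letter : Option (Option Bool ⊕ Cell A Q) → Option (Option Bool)
  | none => none
  | some (.inl a) => some a
  | some (.inr c) => c.src

/-- The rules for a window that shows a symbol `s`, its successor `s'`, the symbol `u` in the same
column of the next row, and the symbol `t` at the same position of the next slice. -/
structure Valid (q₀ : Q) (δ : Q → A → A → Q) (good : Q → Bool → Prop)
    (s s' u t : Option (Option (Option Bool ⊕ Cell A Q))) : Prop where
  /-- The ends of the rows are aligned. -/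
  aligned : ∀ a b, s = some a → u = some b →
    ((letter b = none ∨ letter b = some none) ↔ (letter a = none ∨ letter a = some none))
  /-- Each slice repeats the input letters. -/
  copied : ∀ a b, s = some a → t = some b → letter b = letter a
  /-- There is a first slice, and it shows the initial state. -/
  init : ∀ a, s = some a → (∀ c, a ≠ some (.inr c)) →
    ∃ c, t = some (some (.inr c)) ∧ c.state = q₀
  /-- The next slice shows the next state. -/
  next : ∀ c c', s = some (some (.inr c)) → t = some (some (.inr c')) →
    c'.state = δ c.state c.vtx c.edg
  /-- The word ends at the end of a slice. -/
  complete : ∀ c, s = some (some (.inr c)) → s' = none → c.src = none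
  /-- A header begins after a separator. -/
  header_start : ∀ a c, s = some a → s' = some (some (.inr c)) → letter a = none →
    c.header = true
  /-- A row that is not a header begins within a slice. -/
  row_start : ∀ a c, s = some a → s' = some (some (.inr c)) → letter a = some none →
    c.header = false
  /-- The letter of the hyperedge is constant along a row. -/
  row : ∀ c c', s = some (some (.inr c)) → s' = some (some (.inr c')) →
    ¬ (c.src = none ∨ c.src = some none) → c'.header = c.header ∧ c'.edg = c.edg
  /-- The letter of the vertex is constant along a column of a slice. -/
  column : ∀ c c', s = some (some (.inr c)) → u = some (some (.inr c')) →
    c'.header = false → c'.vtx = c.vtx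
  /-- The last states comply with the incidences. -/
  accept : ∀ c b, s = some (some (.inr c)) → t = none → c.header = false →
    c.src = some (some b) → good (δ c.state c.vtx c.edg) b

end Cell

section word

variable {Γ Δ : Type} (x : List Γ) (y : List Δ)

lemma length_pairWord : (pairWord (x, y)).length = x.length + 1 + y.length := by
  simp [pairWord]; omega

lemma getElem?_pairWord_left (i : ℕ) (hi : i < x.length) :
    (pairWord (x, y))[i]? = some (some (.inl x[i])) := by
  rw [pairWord, List.getElem?_append_left (by simpa using hi)]
  simp [hi]

lemma getElem?_pairWord_sep : (pairWord (x, y))[x.length]? = some none := by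
  rw [pairWord, List.getElem?_append_right (by simp)]
  simp

lemma getElem?_pairWord_right (i : ℕ) :
    (pairWord (x, y))[x.length + 1 + i]? = y[i]?.map fun b => some (.inr b) := by
  rw [pairWord, List.getElem?_append_right (by simp; omega)]
  simp [show x.length + 1 + i - x.length = i + 1 by omega]

end word

lemma apply_mod_of_periodic_below {α : Type*} (f : ℕ → α) (d T : ℕ) (hd : 0 < d)
    (h : ∀ i, i + d < T → f (i + d) = f i) (i : ℕ) (hi : i < T) : f i = f (i % d) := by
  induction i using Nat.strong_induction_on with
  | _ i ih =>
    by_cases hlt : i < d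
    · rw [Nat.mod_eq_of_lt hlt]
    · obtain ⟨k, rfl⟩ : ∃ k, i = k + d := ⟨i - d, by omega⟩
      rw [h k hi, ih k (by omega) (by omega), Nat.add_mod_right]

namespace Cell

open Hypergraph

variable {A Q : Type} (q₀ : Q) (δ : Q → A → A → Q) (good : Q → Bool → Prop)

/-- The certificate of `T` slices for the streams `ξ` of the vertices and `η` of the hyperedges:
its cell at position `k`. -/
def ofStreams (n : ℕ) (x : List (Option Bool)) (ξ η : ℕ → ℕ → A) (k : ℕ) : Cell A Q where
  src := x[k % (x.length + 1)]?
  header := decide (k % (x.length + 1) < n + 1)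
  vtx := ξ (k % (n + 1)) (k / (x.length + 1))
  edg := η (k % (x.length + 1) / (n + 1) - 1) (k / (x.length + 1))
  state := runStreams q₀ δ (ξ (k % (n + 1))) (η (k % (x.length + 1) / (n + 1) - 1))
    (k / (x.length + 1))

lemma state_ofStreams_add (n : ℕ) (x : List (Option Bool)) (ξ η : ℕ → ℕ → A) (k : ℕ)
    (hd : n + 1 ∣ x.length + 1) :
    (ofStreams q₀ δ n x ξ η (k + (x.length + 1))).state =
      δ (ofStreams q₀ δ n x ξ η k).state (ofStreams q₀ δ n x ξ η k).vtx
        (ofStreams q₀ δ n x ξ η k).edg := by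
  have h₁ : (k + (x.length + 1)) % (n + 1) = k % (n + 1) := by
    obtain ⟨d, hd⟩ := hd
    rw [hd, Nat.add_mul_mod_self_left]
  simp only [ofStreams, Nat.add_mod_right, Nat.add_div_right k (Nat.add_one_pos x.length), h₁]
  rfl

section pairWord

variable {x : List (Option Bool)} {y : List (Cell A Q)} {f : ℕ → Cell A Q} {l : ℕ}
  (hy : y = (List.range l).map f)

include hy

lemma getElem?_pairWord_of_lt {i : ℕ} (hi : i < l) :
    (pairWord (x, y))[x.length + 1 + i]? = some (some (.inr (f i))) := by
  rw [getElem?_pairWord_right, hy]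
  simp [hi]

lemma le_of_getElem?_pairWord_eq_none {i : ℕ} (hi : (pairWord (x, y))[i]? = none) :
    x.length + 1 + l ≤ i := by
  rw [List.getElem?_eq_none_iff, length_pairWord, hy] at hi
  simpa using hi

lemma exists_of_getElem?_pairWord_eq_cell {i : ℕ} {c : Cell A Q}
    (hi : (pairWord (x, y))[i]? = some (some (.inr c))) :
    ∃ k < l, i = x.length + 1 + k ∧ c = f k := by
  rcases lt_trichotomy i x.length with h | rfl | h
  · rw [getElem?_pairWord_left x y i h] at hi
    simp at hi
  · rw [getElem?_pairWord_sep] at hi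
    simp at hi
  · obtain ⟨k, rfl⟩ : ∃ k, i = x.length + 1 + k := ⟨i - (x.length + 1), by omega⟩
    have hk : k < l := by
      by_contra hcon
      rw [List.getElem?_eq_none (by rw [length_pairWord, hy]; simp; omega)] at hi
      simp at hi
    rw [getElem?_pairWord_of_lt hy hk] at hi
    exact ⟨k, hk, rfl, by simpa using hi.symm⟩

lemma letter_of_getElem?_pairWord_eq (hf : ∀ k, (f k).src = x[k % (x.length + 1)]?) {i : ℕ}
    {a : Option (Option Bool ⊕ Cell A Q)} (hi : (pairWord (x, y))[i]? = some a) :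
    letter a = x[i % (x.length + 1)]? := by
  rcases lt_trichotomy i x.length with h | rfl | h
  · rw [getElem?_pairWord_left x y i h, Option.some_inj] at hi
    rw [← hi, Nat.mod_eq_of_lt (by omega), List.getElem?_eq_getElem h]
    rfl
  · rw [getElem?_pairWord_sep, Option.some_inj] at hi
    rw [← hi, Nat.mod_eq_of_lt (by omega), List.getElem?_eq_none le_rfl]
    rfl
  · obtain ⟨k, rfl⟩ : ∃ k, i = x.length + 1 + k := ⟨i - (x.length + 1), by omega⟩
    have hk : k < l := by
      by_contra hcon
      rw [List.getElem?_eq_none (by rw [length_pairWord, hy]; simp; omega)] at hi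
      simp at hi
    rw [getElem?_pairWord_of_lt hy hk, Option.some_inj] at hi
    rw [← hi, Nat.add_mod_left]
    exact hf k

end pairWord

lemma succ_mod_of_ne {k d : ℕ} (h : k % (d + 1) ≠ d) : (k + 1) % (d + 1) = k % (d + 1) + 1 := by
  have := Nat.mod_lt k (Nat.add_one_pos d)
  rw [Nat.add_mod]
  rcases Nat.eq_zero_or_pos d with rfl | hd
  · omega
  · rw [Nat.mod_eq_of_lt (a := 1) (by omega), Nat.mod_eq_of_lt (by omega)]

lemma succ_div_of_ne {k d : ℕ} (h : k % (d + 1) ≠ d) : (k + 1) / (d + 1) = k / (d + 1) := by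
  have h₁ := Nat.div_add_mod' k (d + 1)
  have h₂ := Nat.div_add_mod' (k + 1) (d + 1)
  rw [succ_mod_of_ne h] at h₂
  exact Nat.eq_of_mul_eq_mul_right (Nat.add_one_pos d) (by omega)

/-- The windows of the certificate that is built from streams are valid. -/
lemma valid_ofStreams {n : ℕ} (rows : List (Fin n → Bool)) (ξ η : ℕ → ℕ → A) (T : ℕ) (hT : 1 ≤ T)
    (h : ∀ (v : Fin n) (e : Fin rows.length),
      good (runStreams q₀ δ (ξ v) (η e) T) (rows[e] v))
    (x : List (Option Bool)) (hx : x = encodeIncidence rows) (y : List (Cell A Q))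
    (hy : y = (List.range (T * (x.length + 1))).map (ofStreams q₀ δ n x ξ η)) (i : ℕ) :
    Valid q₀ δ good (pairWord (x, y))[i]? (pairWord (x, y))[i + 1]?
      (pairWord (x, y))[i + (n + 1)]? (pairWord (x, y))[i + (x.length + 1)]? := by
  have hlen : x.length + 1 = (rows.length + 1) * (n + 1) := hx ▸ length_encodeIncidence rows
  have hd : n + 1 ∣ x.length + 1 := ⟨rows.length + 1, by rw [hlen, mul_comm]⟩
  have hdel : ∀ k, (x[k % (x.length + 1)]? = none ∨ x[k % (x.length + 1)]? = some none) ↔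
      k % (n + 1) = n := fun k => by rw [hx]; exact getElem?_encodeIncidence_delimiter rows k
  have hletter : ∀ {i a}, (pairWord (x, y))[i]? = some a → letter a = x[i % (x.length + 1)]? :=
    letter_of_getElem?_pairWord_eq hy fun _ => rfl
  have hcell : ∀ {i c}, (pairWord (x, y))[i]? = some (some (.inr c)) →
      ∃ k < T * (x.length + 1), i = x.length + 1 + k ∧ c = ofStreams q₀ δ n x ξ η k :=
    exists_of_getElem?_pairWord_eq_cell hy
  have hlast : ∀ k, x[k % (x.length + 1)]? = none → k % (x.length + 1) = x.length := by
    intro k hk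
    have := Nat.mod_lt k (Nat.add_one_pos x.length)
    rw [List.getElem?_eq_none_iff] at hk
    omega
  constructor
  · intro a b ha hb
    rw [hletter ha, hletter hb, hdel, hdel, Nat.add_mod_right]
  · intro a b ha hb
    rw [hletter ha, hletter hb, Nat.add_mod_right]
  · intro a ha hc
    have hi : i < x.length + 1 := by
      by_contra hcon
      obtain ⟨k, rfl⟩ : ∃ k, i = x.length + 1 + k := ⟨i - (x.length + 1), by omega⟩
      by_cases hk : k < T * (x.length + 1)
      · rw [getElem?_pairWord_of_lt hy hk] at ha
        exact hc _ (by simpa using ha.symm)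
      · rw [List.getElem?_eq_none (by rw [length_pairWord, hy]; simp; omega)] at ha
        simp at ha
    refine ⟨ofStreams q₀ δ n x ξ η i, ?_, ?_⟩
    · rw [add_comm, getElem?_pairWord_of_lt hy (by nlinarith)]
    · simp [ofStreams, Nat.div_eq_of_lt hi, runStreams]
  · intro c c' hc hc'
    obtain ⟨k, hk, rfl, rfl⟩ := hcell hc
    obtain ⟨k', hk', hkk', rfl⟩ := hcell hc'
    obtain rfl : k' = k + (x.length + 1) := by omega
    exact state_ofStreams_add q₀ δ n x ξ η k hd
  · intro c hc hn
    obtain ⟨k, hk, rfl, rfl⟩ := hcell hc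
    have := le_of_getElem?_pairWord_eq_none hy hn
    have hk' : k + 1 = T * (x.length + 1) := by omega
    refine List.getElem?_eq_none ?_
    by_contra hcon
    have hne : k % (x.length + 1) ≠ x.length := by omega
    have h₁ := succ_mod_of_ne hne
    rw [hk', Nat.mul_mod_left] at h₁
    omega
  · intro a c ha hc hn
    rw [hletter ha] at hn
    have hi := hlast i hn
    obtain ⟨k, hk, hik, rfl⟩ := hcell hc
    have : k % (x.length + 1) = 0 := by
      have h₁ : (i + 1) % (x.length + 1) = 0 := by rw [Nat.add_mod, hi]; simp
      rwa [hik, Nat.add_mod_left] at h₁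
    simp [ofStreams, this]
  · intro a c ha hc hn
    rw [hletter ha] at hn
    have h₁ := (hdel i).1 (.inr hn)
    have hne : i % (x.length + 1) ≠ x.length := by
      intro hcon
      rw [hcon, List.getElem?_eq_none le_rfl] at hn
      simp at hn
    have h₂ := succ_mod_of_ne hne
    obtain ⟨k, hk, hik, rfl⟩ := hcell hc
    rw [hik, Nat.add_mod_left] at h₂
    have h₃ : i % (x.length + 1) % (n + 1) = n := by rw [Nat.mod_mod_of_dvd _ hd, h₁]
    have h₄ := Nat.mod_le (i % (x.length + 1)) (n + 1)
    simp only [ofStreams, decide_eq_false_iff_not]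
    omega
  · intro c c' hc hc' hn
    obtain ⟨k, hk, rfl, rfl⟩ := hcell hc
    obtain ⟨k', hk', hkk', rfl⟩ := hcell hc'
    obtain rfl : k' = k + 1 := by omega
    have hn' : ¬ k % (n + 1) = n := fun hcon => hn ((hdel k).2 hcon)
    have hne : k % (x.length + 1) ≠ x.length := by
      intro hcon
      refine hn (.inl ?_)
      change x[k % (x.length + 1)]? = none
      rw [hcon, List.getElem?_eq_none le_rfl]
    have h₃ : k % (x.length + 1) % (n + 1) ≠ n := by rwa [Nat.mod_mod_of_dvd _ hd]
    have h₄ : k % (x.length + 1) ≠ n := by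
      intro hcon
      rw [hcon, Nat.mod_eq_of_lt (by omega)] at h₃
      exact h₃ rfl
    simp only [ofStreams, succ_mod_of_ne hne, succ_div_of_ne hne, succ_div_of_ne h₃, and_true,
      decide_eq_decide]
    omega
  · intro c c' hc hc' hn
    obtain ⟨k, hk, rfl, rfl⟩ := hcell hc
    obtain ⟨k', hk', hkk', rfl⟩ := hcell hc'
    obtain rfl : k' = k + (n + 1) := by omega
    simp only [ofStreams, decide_eq_false_iff_not, not_lt] at hn
    have h₁ := Nat.div_add_mod' k (x.length + 1)
    have h₂ := Nat.mod_lt k (Nat.add_one_pos x.length)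
    have h₅ : k % (x.length + 1) + (n + 1) < x.length + 1 := by
      by_contra hcon
      have h₃ : (k + (n + 1)) % (x.length + 1) =
          (k % (x.length + 1) + (n + 1) - (x.length + 1)) := by
        have h₇ : n + 1 ≤ x.length + 1 := Nat.le_of_dvd (by omega) hd
        rw [show k + (n + 1) = (k % (x.length + 1) + (n + 1) - (x.length + 1)) +
          (k / (x.length + 1) + 1) * (x.length + 1) by rw [add_mul]; omega,
          Nat.add_mul_mod_self_right, Nat.mod_eq_of_lt (by omega)]
      omega
    have h₆ : (k + (n + 1)) / (x.length + 1) = k / (x.length + 1) := by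
      rw [Nat.div_eq_iff (Nat.add_one_pos _)]
      omega
    simp only [ofStreams, Nat.add_mod_right, h₆]
  · intro c b hc ht hn hb
    obtain ⟨k, hk, rfl, rfl⟩ := hcell hc
    have h₁ := le_of_getElem?_pairWord_eq_none hy ht
    simp only [ofStreams, decide_eq_false_iff_not, not_lt] at hn hb
    have h₂ : k / (x.length + 1) + 1 = T := by
      have h₃ := (Nat.div_lt_iff_lt_mul (Nat.add_one_pos x.length)).2 hk
      have h₄ : T - 1 ≤ k / (x.length + 1) := by
        rw [Nat.le_div_iff_mul_le (Nat.add_one_pos _), Nat.sub_mul]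
        omega
      omega
    have hv : k % (n + 1) < n := by
      have h₃ : ¬ k % (n + 1) = n := fun hcon => by
        have := (hdel k).2 hcon
        rw [hb] at this
        simp at this
      have := Nat.mod_lt k (Nat.add_one_pos n)
      omega
    have hr := Nat.mod_lt k (Nat.add_one_pos x.length)
    have he : k % (x.length + 1) / (n + 1) - 1 < rows.length := by
      have h₃ := (Nat.div_lt_iff_lt_mul (Nat.add_one_pos n)).2 (hr.trans_eq hlen)
      have h₄ := (Nat.one_le_div_iff (Nat.add_one_pos n)).2 hn
      omega
    have h₅ := h ⟨_, hv⟩ ⟨_, he⟩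
    have h₆ := getElem?_encodeIncidence_row rows ⟨_, he⟩ ⟨_, hv⟩
    have h₇ : k % (x.length + 1) / (n + 1) - 1 + 1 = k % (x.length + 1) / (n + 1) := by
      have h₄ := (Nat.one_le_div_iff (Nat.add_one_pos n)).2 hn
      omega
    have h₈ : k % (x.length + 1) / (n + 1) * (n + 1) + k % (n + 1) = k % (x.length + 1) := by
      rw [← Nat.mod_mod_of_dvd k hd, Nat.div_add_mod']
    simp only [h₇, h₈, ← hx] at h₆
    rw [hb, Option.some_inj, Option.some_inj] at h₆
    rw [← h₆, ← h₂] at h₅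
    exact h₅

lemma runStreams_congr {ξ ξ' η η' : ℕ → A} {t : ℕ} (hξ : ∀ j < t, ξ j = ξ' j)
    (hη : ∀ j < t, η j = η' j) : runStreams q₀ δ ξ η t = runStreams q₀ δ ξ' η' t := by
  induction t with
  | zero => rfl
  | succ t ih =>
    rw [runStreams, runStreams, hξ t (by omega), hη t (by omega),
      ih (fun j hj => hξ j (by omega)) (fun j hj => hη j (by omega))]

/-- Streams can be read off from a word whose windows are valid. -/
lemma exists_streams_of_valid [Inhabited A] (n : ℕ) (x : List (Option Bool))
    (y : List (Cell A Q)) (hn : ∀ v < n, x[v]? = some (some true))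
    (h : ∀ i < (pairWord (x, y)).length, Valid q₀ δ good (pairWord (x, y))[i]?
      (pairWord (x, y))[i + 1]? (pairWord (x, y))[i + (n + 1)]?
      (pairWord (x, y))[i + (x.length + 1)]?) :
    ∃ (rows : List (Fin n → Bool)) (T : ℕ) (ξ η : ℕ → ℕ → A), x = encodeIncidence rows ∧
      ∀ (v : Fin n) (e : Fin rows.length),
        good (runStreams q₀ δ (ξ v) (η e) T) (rows[e] v) := by
  set M := x.length + 1 with hMdef
  set W := pairWord (x, y) with hW
  have htot : W.length = M + y.length := length_pairWord x y
  have hsome : ∀ i, i < M + y.length → ∃ a, W[i]? = some a := fun i hi =>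
    ⟨_, List.getElem?_eq_getElem (by rwa [htot])⟩
  -- the input letter at each position, and the ends of rows
  let l : ℕ → Option (Option Bool) := fun i => W[i]?.bind letter
  have hl : ∀ {i a}, W[i]? = some a → letter a = l i := fun hi => by simp [l, hi]
  have hlx : ∀ i < M, l i = x[i]? := by
    intro i hi
    rcases Nat.lt_succ_iff_lt_or_eq.1 hi with h' | rfl
    · rw [← hl (getElem?_pairWord_left x y i h'), List.getElem?_eq_getElem h']
      rfl
    · rw [← hl (getElem?_pairWord_sep x y), List.getElem?_eq_none le_rfl]
      rfl
  have hlM : ∀ i < M + y.length, l i = x[i % M]? := by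
    intro i hi
    rw [← hlx _ (Nat.mod_lt i (Nat.add_one_pos x.length))]
    refine apply_mod_of_periodic_below l M _ (Nat.add_one_pos _) (fun k hk => ?_) i hi
    obtain ⟨a, ha⟩ := hsome k (by omega)
    obtain ⟨b, hb⟩ := hsome (k + M) hk
    rw [← hl ha, ← hl hb]
    exact (h k (by omega)).copied a b ha hb
  let D : ℕ → Prop := fun i => l i = none ∨ l i = some none
  have hDper : ∀ i < M + y.length, D i = D (i % (n + 1)) := by
    refine apply_mod_of_periodic_below D (n + 1) _ (Nat.add_one_pos _) (fun k hk => ?_)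
    obtain ⟨a, ha⟩ := hsome k (by omega)
    obtain ⟨b, hb⟩ := hsome (k + (n + 1)) hk
    simp only [D, ← hl ha, ← hl hb]
    exact propext ((h k (by omega)).aligned a b ha hb)
  have hnx : n ≤ x.length := by
    by_contra hcon
    have := hn x.length (by omega)
    simp at this
  have hDlt : ∀ i < n, ¬ D i := by
    intro i hi
    simp [D, hlx i (by omega), hn i hi]
  have hDN : D x.length := .inl (by rw [hlx _ (by omega), List.getElem?_eq_none le_rfl])
  have hNmod : x.length % (n + 1) = n := by
    have h₁ := Nat.mod_lt x.length (Nat.add_one_pos n)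
    by_contra hcon
    refine hDlt (x.length % (n + 1)) (by omega) ?_
    rwa [← hDper _ (by omega)]
  have hD : ∀ i < M + y.length, D i ↔ i % (n + 1) = n := by
    intro i hi
    rw [hDper i hi]
    constructor
    · intro hDi
      have h₁ := Nat.mod_lt i (Nat.add_one_pos n)
      by_contra hcon
      exact hDlt _ (by omega) hDi
    · intro hi'
      rw [hi', ← hNmod, ← hDper _ (by omega)]
      exact hDN
  -- the shape of the input word
  obtain ⟨m, hm⟩ : ∃ m, M = (m + 1) * (n + 1) := by
    have h₁ := Nat.div_add_mod' x.length (n + 1)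
    exact ⟨x.length / (n + 1), by rw [add_mul]; omega⟩
  have hlt : ∀ e v, e ≤ m → v ≤ n → e * (n + 1) + v < M := by
    intro e v he hv
    rw [hm]
    nlinarith
  have hhash : ∀ e < m, x[e * (n + 1) + n]? = some none := by
    intro e he
    have h₁ : e * (n + 1) + n < x.length := by
      have : (e + 1) * (n + 1) < (m + 1) * (n + 1) := by nlinarith
      rw [← hm, add_mul e] at this
      omega
    have h₂ := (hD (e * (n + 1) + n) (by omega)).2
      (by rw [Nat.mul_add_mod_self_right, Nat.mod_eq_of_lt (by omega)])
    rcases h₂ with h₂ | h₂ <;> rw [hlx _ (by omega)] at h₂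
    · rw [List.getElem?_eq_none_iff] at h₂
      omega
    · exact h₂
  -- the cells of the certificate
  let Y : ℕ → Cell A Q := fun k => y.getD k ⟨none, false, default, default, q₀⟩
  have hY : ∀ {k}, k < y.length → W[M + k]? = some (some (.inr (Y k))) := by
    intro k hk
    rw [hW, getElem?_pairWord_right]
    simp [Y, hk]
  have hinit : ∀ i < M, i < y.length ∧ (Y i).state = q₀ := by
    intro i hi
    obtain ⟨a, ha⟩ := hsome i (by omega)
    obtain ⟨c, hc, hc'⟩ := (h i (by omega)).init a ha (by
      rintro c rfl
      rcases Nat.lt_succ_iff_lt_or_eq.1 hi with h' | rfl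
      · rw [hW, getElem?_pairWord_left x y i h'] at ha
        simp at ha
      · rw [hW, getElem?_pairWord_sep] at ha
        simp at ha)
    have hlen : i < y.length := by
      by_contra hcon
      rw [List.getElem?_eq_none (by omega)] at hc
      simp at hc
    rw [add_comm, hY hlen] at hc
    obtain rfl : Y i = c := by simpa using hc
    exact ⟨hlen, hc'⟩
  have hsrc : ∀ k < y.length, (Y k).src = x[k % M]? := by
    intro k hk
    have h₁ := hlM (M + k) (by omega)
    rw [Nat.add_mod_left] at h₁
    rw [← h₁, ← hl (hY hk)]
    rfl
  have hdelim : ∀ k < y.length, ((Y k).src = none ∨ (Y k).src = some none) ↔ k % (n + 1) = n := by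
    intro k hk
    have h₁ := hD (M + k) (by omega)
    rw [hm, Nat.mul_add_mod_self_right] at h₁
    rw [← h₁, ← hm]
    change _ ↔ l (M + k) = none ∨ l (M + k) = some none
    rw [← hl (hY hk)]
    rfl
  obtain ⟨T, hT⟩ : ∃ T, y.length = (T + 1) * M := by
    have h₀ := (hinit x.length (by omega)).1
    have h₁ := (h (M + (y.length - 1)) (by omega)).complete _ (hY (by omega))
      (List.getElem?_eq_none (by omega))
    rw [hsrc _ (by omega), List.getElem?_eq_none_iff] at h₁
    have h₂ := Nat.mod_lt (y.length - 1) (Nat.add_one_pos x.length)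
    have h₃ := Nat.div_add_mod' (y.length - 1) M
    rw [← hMdef] at h₂
    exact ⟨(y.length - 1) / M, by rw [add_mul]; omega⟩
  have hrange : ∀ j r, j ≤ T → r < M → j * M + r < y.length := by
    intro j r hj hr
    rw [hT]
    nlinarith
  have hmod : ∀ j e v, v ≤ n → (j * M + (e * (n + 1) + v)) % (n + 1) = v := by
    intro j e v hv
    rw [hm, show j * ((m + 1) * (n + 1)) + (e * (n + 1) + v) =
      (j * (m + 1) + e) * (n + 1) + v by ring, Nat.mul_add_mod_self_right,
      Nat.mod_eq_of_lt (by omega)]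
  have hrow : ∀ j e, j ≤ T → e < m → ∀ v ≤ n,
      (Y (j * M + ((e + 1) * (n + 1) + v))).header = false ∧
      (Y (j * M + ((e + 1) * (n + 1) + v))).edg = (Y (j * M + (e + 1) * (n + 1))).edg := by
    intro j e hj he v hv
    induction v with
    | zero =>
      refine ⟨?_, rfl⟩
      have h₁ := hrange j _ hj (hlt (e + 1) 0 (by omega) (by omega))
      have h₂ : j * M + ((e + 1) * (n + 1) + 0) = j * M + (e * (n + 1) + n) + 1 := by ring
      rw [h₂] at h₁ ⊢
      refine (h (M + (j * M + (e * (n + 1) + n))) (by omega)).row_start _ _ (hY (by omega))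
        (hY h₁) ?_
      change (Y _).src = _
      rw [hsrc _ (by omega), Nat.mul_add_mod_self_right,
        Nat.mod_eq_of_lt (hlt e n he.le le_rfl), hhash e he]
    | succ v ih =>
      have h₁ := hrange j _ hj (hlt (e + 1) (v + 1) (by omega) hv)
      obtain ⟨ih₁, ih₂⟩ := ih (by omega)
      have h₂ := (h (M + (j * M + ((e + 1) * (n + 1) + v))) (by omega)).row _ _ (hY (by omega))
        (hY h₁) (by rw [hdelim _ (by omega), hmod _ _ _ (by omega)]; omega)
      exact ⟨h₂.1.trans ih₁, h₂.2.trans ih₂⟩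
  have hcol : ∀ j v, j ≤ T → v ≤ n → ∀ e ≤ m,
      (Y (j * M + (e * (n + 1) + v))).vtx = (Y (j * M + v)).vtx := by
    intro j v hj hv e he
    induction e with
    | zero => simp
    | succ e ih =>
      have h₁ := hrange j _ hj (hlt (e + 1) v he hv)
      have h₂ : j * M + ((e + 1) * (n + 1) + v) = j * M + (e * (n + 1) + v) + (n + 1) := by ring
      have h₃ := (hrow j e hj (by omega) v hv).1
      rw [h₂] at h₁ h₃ ⊢
      rw [← ih (by omega)]
      exact (h (M + (j * M + (e * (n + 1) + v))) (by omega)).column _ _ (hY (by omega))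
        (by rw [add_assoc]; exact hY h₁) h₃
  have hstate : ∀ r < M, ∀ j ≤ T, (Y (j * M + r)).state =
      runStreams q₀ δ (fun j => (Y (j * M + r)).vtx) (fun j => (Y (j * M + r)).edg) j := by
    intro r hr j hj
    induction j with
    | zero => rw [zero_mul, zero_add]; exact (hinit r hr).2
    | succ j ih =>
      have h₁ := hrange (j + 1) r hj hr
      have h₂ : (j + 1) * M + r = j * M + r + M := by ring
      rw [runStreams, ← ih (by omega)]
      rw [h₂] at h₁ ⊢
      exact (h (M + (j * M + r)) (by omega)).next _ _ (hY (by omega))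
        (by rw [add_assoc]; exact hY h₁)
  let rows : List (Fin n → Bool) := List.ofFn fun (e : Fin m) (v : Fin n) =>
    decide (x[((e : ℕ) + 1) * (n + 1) + v]? = some (some true))
  have hrowsm : rows.length = m := by simp [rows]
  have hrows : ∀ (e : Fin rows.length) (v : Fin n),
      x[((e : ℕ) + 1) * (n + 1) + v]? = some (some (rows[e] v)) := by
    intro e v
    have he := e.2
    have h₁ := hlt (e + 1) v (by omega) v.2.le
    have h₂ : ¬ D (((e : ℕ) + 1) * (n + 1) + v) := by
      rw [hD _ (by omega), Nat.mul_add_mod_self_right, Nat.mod_eq_of_lt (by omega)]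
      exact v.2.ne
    simp only [D, hlx _ h₁] at h₂
    simp only [rows, Fin.getElem_fin, List.getElem_ofFn]
    rcases hb : x[((e : ℕ) + 1) * (n + 1) + v]? with _ | _ | _ | _ <;> simp_all
  refine ⟨rows, T + 1, fun v j => (Y (j * M + v)).vtx,
    fun e j => (Y (j * M + (e + 1) * (n + 1))).edg, ?_, fun v e => ?_⟩
  · exact eq_encodeIncidence rows x (by rw [hrowsm]; exact hm) hn (by rwa [hrowsm]) hrows
  · have he := e.2
    have hr := hlt (e + 1) v (by omega) v.2.le
    have h₁ := hrange T _ le_rfl hr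
    have h₂ := (h (M + (T * M + ((e + 1) * (n + 1) + v))) (by omega)).accept _ (rows[e] v)
      (hY h₁) (List.getElem?_eq_none (by rw [htot, hT, add_mul]; omega))
      (hrow T e le_rfl (by omega) v v.2.le).1
      (by rw [hsrc _ h₁, Nat.mul_add_mod_self_right, Nat.mod_eq_of_lt hr, hrows e v])
    rw [hstate _ hr T le_rfl, hcol T v le_rfl v.2.le _ (by omega),
      (hrow T e le_rfl (by omega) v v.2.le).2] at h₂
    rw [runStreams, ← runStreams_congr q₀ δ
      (fun j hj => hcol j v hj.le v.2.le (e + 1) (by omega))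
      (fun j hj => (hrow j e hj.le (by omega) v v.2.le).2)]
    exact h₂

end Cell

/-- A language is in NP if its members are the hypergraphs for which there are streams of
polynomial length, one for each vertex and one for each hyperedge, such that a fixed finite
automaton verifies the incidence of every pair from the two streams. -/
theorem inNP_of_streams {A Q : Type} [Finite A] [Inhabited A] [Finite Q] (q₀ : Q)
    (δ : Q → A → A → Q) (good : Q → Bool → Prop) (L : Language (Option Bool)) (ℓ : Polynomial ℕ)
    (hsound : ∀ (n : ℕ) (rows : List (Fin n → Bool)) (T : ℕ) (ξ η : ℕ → ℕ → A),
      (∀ (v : Fin n) (e : Fin rows.length),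
        good (runStreams q₀ δ (ξ v) (η e) T) (rows[e] v)) →
      Hypergraph.encodeIncidence rows ∈ L)
    (hcomplete : ∀ x ∈ L, ∃ (n : ℕ) (rows : List (Fin n → Bool)) (T : ℕ) (ξ η : ℕ → ℕ → A),
      x = Hypergraph.encodeIncidence rows ∧ 1 ≤ T ∧ T ≤ ℓ.eval x.length ∧
      ∀ (v : Fin n) (e : Fin rows.length),
        good (runStreams q₀ δ (ξ v) (η e) T) (rows[e] v)) :
    InNP L := by
  classical
  let one : Option (Option Bool ⊕ Cell A Q) → Bool
    | some (.inl (some true)) => true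
    | _ => false
  let R (s s' u t : Option (Option (Option Bool ⊕ Cell A Q))) : Bool :=
    decide (Cell.Valid q₀ δ good s s' u t)
  have key : ∀ (n : ℕ) (x : List (Option Bool)) (y : List (Cell A Q)),
      (∀ v < n, x[v]? = some (some true)) → x[n]? ≠ some (some true) → n ≤ x.length →
      (WindowCheck.check one Option.isNone R (pairWord (x, y)) = true ↔
        ∀ i < (pairWord (x, y)).length, Cell.Valid q₀ δ good (pairWord (x, y))[i]?
          (pairWord (x, y))[i + 1]? (pairWord (x, y))[i + (n + 1)]?
          (pairWord (x, y))[i + (x.length + 1)]?) := by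
    intro n x y hn hn' hle
    rw [WindowCheck.check_iff one Option.isNone R _ n x.length]
    · simp only [R, decide_eq_true_eq]
    · intro i hi
      refine ⟨_, getElem?_pairWord_left x y i (by omega), ?_⟩
      have := hn i hi
      rw [List.getElem?_eq_getElem (by omega), Option.some_inj] at this
      rw [this]
    · rcases hle.lt_or_eq with hlt | rfl
      · refine ⟨_, getElem?_pairWord_left x y n hlt, ?_⟩
        rw [List.getElem?_eq_getElem hlt, Ne, Option.some_inj] at hn'
        match hxn : x[n] with
        | some true => exact absurd hxn hn'
        | some false => rfl
        | none => rfl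
      · exact ⟨_, getElem?_pairWord_sep x y, rfl⟩
    · exact fun i hi => ⟨_, getElem?_pairWord_left x y i hi, rfl⟩
    · exact ⟨_, getElem?_pairWord_sep x y, rfl⟩
  have : Inhabited (Option (Option Bool ⊕ Cell A Q)) := ⟨none⟩
  refine ⟨Cell A Q, inferInstance, fun xy => WindowCheck.check one Option.isNone R (pairWord xy),
    ℓ * (Polynomial.X + 1), WindowCheck.nonempty_computableInPolyTime _ _ _ _, fun x => ⟨?_, ?_⟩⟩
  · intro hxL
    obtain ⟨n, rows, T, ξ, η, hx, hT, hTℓ, h⟩ := hcomplete x hxL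
    have hlen := Hypergraph.length_encodeIncidence rows
    rw [← hx] at hlen
    refine ⟨(List.range (T * (x.length + 1))).map (Cell.ofStreams q₀ δ n x ξ η), ?_, ?_⟩
    · rw [List.length_map, List.length_range, Polynomial.eval_mul]
      simpa using Nat.mul_le_mul_right (x.length + 1) hTℓ
    · refine (key n x _ (fun v hv => ?_) ?_ ?_).2 fun i _ =>
        Cell.valid_ofStreams q₀ δ good rows ξ η T hT h x hx _ rfl i
      · rw [hx]; exact Hypergraph.getElem?_encodeIncidence_header rows v hv
      · rcases Nat.eq_zero_or_pos rows.length with h0 | hpos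
        · rw [List.getElem?_eq_none (by rw [h0] at hlen; omega)]
          simp
        · have := Hypergraph.getElem?_encodeIncidence_hash rows 0 hpos
          rw [hx]
          rw [zero_mul, zero_add] at this
          simp [this]
      · nlinarith
  · rintro ⟨y, -, hy⟩
    -- `n` is the length of the leading block of ones
    let n := (x.takeWhile (· == some true)).length
    have hnle : n ≤ x.length := (List.takeWhile_prefix _).length_le
    have hn : ∀ v < n, x[v]? = some (some true) := by
      intro v hv
      have h₁ := (List.takeWhile_prefix (· == some true) (l := x)).getElem hv
      have h₂ := List.mem_takeWhile_imp (List.getElem_mem hv)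
      rw [List.getElem?_eq_getElem (by omega), ← h₁]
      simpa using h₂
    have hn' : x[n]? ≠ some (some true) := by
      intro hcon
      have h₁ := List.takeWhile_append_dropWhile (p := (· == some true)) (l := x)
      have h₂ : x[n]? = (x.dropWhile (· == some true))[0]? := by
        conv_lhs => rw [← h₁]
        rw [List.getElem?_append_right le_rfl, Nat.sub_self]
      rw [hcon, ← List.head?_eq_getElem?] at h₂
      have := List.head?_dropWhile_not (· == some true) x
      rw [← h₂] at this
      simp at this
    obtain ⟨rows, T, ξ, η, hx, h⟩ := Cell.exists_streams_of_valid q₀ δ good n x y hn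
      ((key n x y hn hn' hnle).1 hy)
    rw [hx]
    exact hsound n rows T ξ η h

/-! ### Small integer solutions of homogeneous sign conditions -/

section SmallSolutions

open Module Submodule

/-- From a feasible point at which the tight constraints do not span, one can move to a feasible
point with more tight constraints. -/
lemma exists_feasible_of_span_tight_ne_top {E I : Type*} [AddCommGroup E] [Module ℝ E]
    [Finite I] (r : I → E) (b : I → ℝ) (hr : span ℝ (Set.range r) = ⊤) (x : Dual ℝ E)
    (hx : ∀ i, b i ≤ x (r i)) (hspan : span ℝ (r '' {i | x (r i) = b i}) ≠ ⊤) :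
    ∃ x' : Dual ℝ E, (∀ i, b i ≤ x' (r i)) ∧
      span ℝ (r '' {i | x (r i) = b i}) < span ℝ (r '' {i | x' (r i) = b i}) := by
  obtain ⟨f, hf, hfS⟩ : ∃ f : Dual ℝ E, (∃ i, f (r i) < 0) ∧
      span ℝ (r '' {i | x (r i) = b i}) ≤ LinearMap.ker f := by
    obtain ⟨f, hf, hfS⟩ := Submodule.exists_le_ker_of_lt_top _ hspan.lt_top
    obtain ⟨i, hi⟩ : ∃ i, f (r i) ≠ 0 := by
      by_contra! hcon
      refine hf (LinearMap.ext_on_range hr fun i => ?_)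
      simpa using hcon i
    rcases hi.lt_or_gt with h | h
    · exact ⟨f, ⟨i, h⟩, hfS⟩
    · refine ⟨-f, ⟨i, by simpa using h⟩, fun v hv => ?_⟩
      simpa using hfS hv
  have hf0 : ∀ i, x (r i) = b i → f (r i) = 0 := fun i hi =>
    hfS (subset_span (Set.mem_image_of_mem r hi))
  -- the largest step in direction `f` that keeps all constraints
  obtain ⟨i₁, hi₁, hmin⟩ := Set.exists_min_image {i | f (r i) < 0}
    (fun i => (x (r i) - b i) / (-f (r i))) (Set.toFinite _) hf
  set s := (x (r i₁) - b i₁) / (-f (r i₁)) with hs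
  have hi₁' : f (r i₁) < 0 := hi₁
  have hs0 : 0 ≤ s := div_nonneg (sub_nonneg.2 (hx i₁)) (by linarith)
  refine ⟨x + s • f, fun i => ?_, ?_⟩
  · simp only [LinearMap.add_apply, LinearMap.smul_apply, smul_eq_mul]
    rcases le_or_gt 0 (f (r i)) with h | h
    · have := hx i
      have := mul_nonneg hs0 h
      linarith
    · have h₁ := hmin i h
      rw [le_div_iff₀ (by linarith)] at h₁
      linarith
  · have htight : x (r i₁) + s * f (r i₁) = b i₁ := by
      rw [hs, div_neg, neg_mul, div_mul_cancel₀ _ hi₁'.ne]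
      ring
    refine lt_of_le_of_ne (span_mono (Set.image_mono fun i hi => ?_)) fun heq => ?_
    · have hi' : x (r i) = b i := hi
      simp [hf0 i hi', hi']
    · have h₁ : r i₁ ∈ span ℝ (r '' {i | (x + s • f) (r i) = b i}) :=
        subset_span (Set.mem_image_of_mem r (by simpa using htight))
      rw [← heq] at h₁
      exact hi₁'.ne (hfS h₁)

/-- A feasible system whose constraints span has a feasible point at which the tight constraints
span. -/
lemma exists_feasible_span_tight_eq_top {E I : Type*} [AddCommGroup E] [Module ℝ E]
    [FiniteDimensional ℝ E] [Finite I] (r : I → E) (b : I → ℝ)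
    (hr : span ℝ (Set.range r) = ⊤) (x : Dual ℝ E) (hx : ∀ i, b i ≤ x (r i)) :
    ∃ x' : Dual ℝ E, (∀ i, b i ≤ x' (r i)) ∧ span ℝ (r '' {i | x' (r i) = b i}) = ⊤ := by
  obtain ⟨_, ⟨x', hx', rfl⟩, hmax⟩ := (wellFounded_gt (α := Submodule ℝ E)).has_min
    {S | ∃ x' : Dual ℝ E, (∀ i, b i ≤ x' (r i)) ∧ S = span ℝ (r '' {i | x' (r i) = b i})}
    ⟨_, x, hx, rfl⟩
  refine ⟨x', hx', ?_⟩
  by_contra hne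
  obtain ⟨x'', hx'', hlt⟩ := exists_feasible_of_span_tight_ne_top r b hr x' hx' hne
  exact hmax _ ⟨x'', hx'', rfl⟩ hlt

/-- A feasible integer system with spanning constraints has a feasible solution of the form
`z / d`, where `d` and the entries of `z` are bounded as the determinants of the system. -/
lemma exists_small_feasible {ι I : Type*} [Fintype ι] [Finite I] (r : I → ι → ℤ) (b : I → ℤ)
    (B : ℕ) (hrB : ∀ i j, |r i j| ≤ B) (hbB : ∀ i, |b i| ≤ B)
    (hr : span ℝ (Set.range fun i j => (r i j : ℝ)) = ⊤) (x : ι → ℝ)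
    (hx : ∀ i, (b i : ℝ) ≤ ∑ j, (r i j : ℝ) * x j) :
    ∃ (z : ι → ℤ) (d : ℤ), 0 < d ∧ (∀ j, |z j| ≤ (Fintype.card ι).factorial * B ^ Fintype.card ι) ∧
      ∀ i, d * b i ≤ ∑ j, r i j * z j := by
  classical
  let r' : I → ι → ℝ := fun i j => (r i j : ℝ)
  let dual (y : ι → ℝ) : Dual ℝ (ι → ℝ) := Fintype.linearCombination ℝ y
  have hdual : ∀ y i, dual y (r' i) = ∑ j, (r i j : ℝ) * y j := fun y i => by
    simp [dual, r', Fintype.linearCombination_apply]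
  obtain ⟨f, hf, hspan⟩ := exists_feasible_span_tight_eq_top r' (fun i => (b i : ℝ)) hr (dual x)
    (fun i => by rw [hdual]; exact hx i)
  obtain ⟨x', rfl⟩ : ∃ x', dual x' = f := by
    refine ⟨fun j => f (Pi.single j 1), LinearMap.pi_ext' fun j => LinearMap.ext_ring ?_⟩
    simp [dual, Fintype.linearCombination_apply, Pi.single_apply]
  obtain ⟨t, htsub, htspan, htli⟩ := exists_linearIndependent ℝ
    (r' '' {i | dual x' (r' i) = b i})
  let bas : Basis t ℝ (ι → ℝ) := Basis.mk htli (by rw [Subtype.range_coe, htspan, hspan])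
  let e : ι ≃ t := (Pi.basisFun ℝ ι).indexEquiv bas
  choose g hg hgr using fun j => htsub (e j).2
  -- the square system of the tight constraints, and its solution by Cramer's rule
  let A : Matrix ι ι ℤ := Matrix.of fun k j => r (g k) j
  let A' : Matrix ι ι ℝ := A.map (Int.castRingHom ℝ)
  have hA' : IsUnit A' := by
    rw [← Matrix.linearIndependent_rows_iff_isUnit]
    have : A'.row = fun k => ((e k : t) : ι → ℝ) := by
      funext k
      rw [← hgr k]
      rfl
    rw [this]
    exact htli.comp e e.injective
  have hdet' : A'.det = (A.det : ℝ) := (RingHom.map_det (Int.castRingHom ℝ) A).symm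
  have hdet : A.det ≠ 0 := by
    intro h0
    have := (Matrix.isUnit_iff_isUnit_det _).1 hA'
    rw [hdet', h0] at this
    simp at this
  let y : ι → ℤ := A.cramer fun k => b (g k)
  have hy : ∀ j, (y j : ℝ) = A.det * x' j := by
    have h₁ : A'.mulVec x' = fun k => (b (g k) : ℝ) := by
      funext k
      have h₂ : dual x' (r' (g k)) = b (g k) := hg k
      rw [hdual] at h₂
      rw [← h₂]
      rfl
    have h₂ : (fun j => (y j : ℝ)) = A'.cramer fun k => (b (g k) : ℝ) := by
      funext j
      simp only [y, Matrix.cramer_apply]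
      rw [← eq_intCast (Int.castRingHom ℝ), RingHom.map_det]
      congr 1
      ext k l
      simp only [RingHom.mapMatrix_apply, Matrix.map_apply, Matrix.updateCol_apply, A']
      split_ifs <;> simp
    intro j
    have h₃ := congrFun h₂ j
    rw [← h₁, Matrix.cramer_eq_adjugate_mulVec, Matrix.mulVec_mulVec, Matrix.adjugate_mul,
      Matrix.smul_mulVec, Matrix.one_mulVec] at h₃
    simpa [hdet'] using h₃
  refine ⟨fun j => A.det.sign * y j, |A.det|, abs_pos.2 hdet, fun j => ?_, fun i => ?_⟩
  · rw [abs_mul, Int.abs_sign_of_ne_zero hdet, one_mul]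
    have := Matrix.det_le (A := A.updateCol j fun k => b (g k)) (abv := AbsoluteValue.abs)
      (x := (B : ℤ)) (fun k l => by
        rw [Matrix.updateCol_apply]
        split_ifs
        · exact hbB _
        · exact hrB _ _)
    simpa [y, Matrix.cramer_apply] using this
  · have h₁ : (b i : ℝ) ≤ ∑ j, (r i j : ℝ) * x' j := by rw [← hdual]; exact hf i
    have h₂ : ((|A.det| * b i : ℤ) : ℝ) ≤ ((∑ j, r i j * (A.det.sign * y j) : ℤ) : ℝ) := by
      have h₃ : ((∑ j, r i j * (A.det.sign * y j) : ℤ) : ℝ) =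
          ((|A.det| : ℤ) : ℝ) * ∑ j, (r i j : ℝ) * x' j := by
        rw [Finset.mul_sum, Int.cast_sum]
        simp only [Int.cast_mul]
        refine Finset.sum_congr rfl fun j _ => ?_
        rw [hy, ← Int.sign_mul_self_eq_abs, Int.cast_mul]
        ring
      rw [h₃, Int.cast_mul]
      exact mul_le_mul_of_nonneg_left h₁ (by exact_mod_cast abs_nonneg _)
    exact_mod_cast h₂

/-- If homogeneous sign conditions with bounded integer coefficients have a nonnegative real
solution, then they have a solution in natural numbers of at most exponential size. -/
theorem exists_nat_sign_eq {ι I : Type*} [Fintype ι] [Finite I] (r : I → ι → ℤ) (B : ℕ)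
    (hB : 1 ≤ B) (hrB : ∀ i j, |r i j| ≤ B) (x : ι → ℝ) (hx : ∀ j, 0 ≤ x j) :
    ∃ z : ι → ℕ, (∀ j, z j ≤ (Fintype.card ι).factorial * B ^ Fintype.card ι) ∧
      ∀ i, SignType.sign (∑ j, r i j * (z j : ℤ)) = SignType.sign (∑ j, (r i j : ℝ) * x j) := by
  classical
  have := Fintype.ofFinite I
  let a : I → ℝ := fun i => ∑ j, (r i j : ℝ) * x j
  -- By homogeneity a strict inequality may be replaced by an inequality with right side `1`; an
  -- equation is a pair of inequalities. The constraints `0 ≤ z j` make the system spanning.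
  let R : I ⊕ I ⊕ ι → ι → ℤ :=
    Sum.elim (fun i => if a i < 0 then -r i else r i)
      (Sum.elim (fun i => if a i = 0 then -r i else 0) fun j => Pi.single j 1)
  let b : I ⊕ I ⊕ ι → ℤ := Sum.elim (fun i => if a i = 0 then 0 else 1) fun _ => 0
  have hneg : ∀ i (y : ι → ℝ), ∑ j, ((-r i) j : ℝ) * y j = -∑ j, (r i j : ℝ) * y j := by
    intro i y
    simp [Finset.sum_neg_distrib]
  obtain ⟨c, hc0, hc⟩ : ∃ c : ℝ, 0 ≤ c ∧ ∀ i, a i ≠ 0 → 1 ≤ c * |a i| := by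
    refine ⟨∑ i, |a i|⁻¹, Finset.sum_nonneg fun i _ => by positivity, fun i hi => ?_⟩
    rw [← inv_mul_cancel₀ (abs_ne_zero.2 hi)]
    exact mul_le_mul_of_nonneg_right
      (Finset.single_le_sum (f := fun i => |a i|⁻¹) (fun i _ => by positivity)
        (Finset.mem_univ i)) (abs_nonneg _)
  have hca : ∀ i, ∑ j, (r i j : ℝ) * (c * x j) = c * a i := by
    intro i
    rw [Finset.mul_sum]
    exact Finset.sum_congr rfl fun j _ => by ring
  obtain ⟨z, d, hd, hz, hfeas⟩ := exists_small_feasible R b B (by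
      rintro (i | i | j) k
      · simp only [R, Sum.elim_inl]
        split_ifs
        · simpa using hrB i k
        · exact hrB i k
      · simp only [R, Sum.elim_inl, Sum.elim_inr]
        split_ifs
        · simpa using hrB i k
        · simp
      · simp only [R, Sum.elim_inr, Pi.single_apply]
        split_ifs <;> simp
        exact_mod_cast hB) (by
      rintro (i | i)
      · simp only [b, Sum.elim_inl]
        split_ifs <;> simp
        exact_mod_cast hB
      · simp [b]) (by
      refine eq_top_iff.2 fun v _ => ?_
      rw [pi_eq_sum_univ v]
      refine Submodule.sum_mem _ fun j _ => Submodule.smul_mem _ _ (subset_span ?_)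
      refine ⟨.inr (.inr j), ?_⟩
      funext k
      simp [R, Pi.single_apply, eq_comm]) (fun j => c * x j) (by
      rintro (i | i | j)
      · simp only [R, b, Sum.elim_inl]
        by_cases h0 : a i = 0
        · rw [if_pos h0, if_neg (by rw [h0]; exact lt_irrefl _), hca, h0]
          simp
        · have := hc i h0
          rw [if_neg h0]
          split_ifs with h
          · rw [hneg, hca, abs_of_neg h] at *
            push_cast
            linarith
          · rw [hca]
            rw [abs_of_nonneg (not_lt.1 h)] at this
            exact_mod_cast this
      · simp only [R, b, Sum.elim_inl, Sum.elim_inr]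
        split_ifs with h
        · rw [hneg, hca, h]
          simp
        · simp
      · have := mul_nonneg hc0 (hx j)
        simpa [R, b, Pi.single_apply] using this)
  have hz0 : ∀ j, 0 ≤ z j := by
    intro j
    simpa [R, b, Pi.single_apply] using hfeas (.inr (.inr j))
  refine ⟨fun j => (z j).toNat, fun j => ?_, fun i => ?_⟩
  · have := (le_abs_self _).trans (hz j)
    rw [Int.toNat_le]
    exact_mod_cast this
  · simp only [Int.toNat_of_nonneg (hz0 _)]
    change _ = SignType.sign (a i)
    have h₁ := hfeas (.inl i)
    have h₂ := hfeas (.inr (.inl i))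
    simp only [R, b, Sum.elim_inl, Sum.elim_inr] at h₁ h₂
    rcases lt_trichotomy (a i) 0 with h | h | h
    · rw [if_neg h.ne, if_pos h] at h₁
      rw [sign_neg h, sign_neg]
      simp only [Pi.neg_apply, neg_mul, Finset.sum_neg_distrib] at h₁
      linarith
    · rw [if_pos h, if_neg (by rw [h]; exact lt_irrefl _)] at h₁
      rw [if_pos h] at h₂
      simp only [Pi.neg_apply, neg_mul, Finset.sum_neg_distrib] at h₂
      rw [h, sign_zero, sign_eq_zero_iff]
      linarith
    · rw [if_neg h.ne', if_neg h.not_gt] at h₁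
      rw [sign_pos h, sign_pos]
      linarith

end SmallSolutions

/-! ### The region of a polygon -/

lemma convex_setOf_sign_eq (s : SignType) : Convex ℝ {u : ℝ | SignType.sign u = s} := by
  cases s
  · rw [show {u : ℝ | SignType.sign u = .zero} = {0} from Set.ext fun u => sign_eq_zero_iff]
    exact convex_singleton 0
  · rw [show {u : ℝ | SignType.sign u = .neg} = Set.Iio 0 from
      Set.ext fun u => sign_eq_neg_one_iff]
    exact convex_Iio 0
  · rw [show {u : ℝ | SignType.sign u = .pos} = Set.Ioi 0 from Set.ext fun u => sign_eq_one_iff]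
    exact convex_Ioi 0

/-- A point of the plane lies on a segment iff it lies on the line of the segment and in its
bounding box. -/
lemma mem_segment_plane_iff (a b q : EuclideanSpace ℝ (Fin 2)) :
    q ∈ segment ℝ a b ↔ (b 0 - a 0) * (q 1 - a 1) - (b 1 - a 1) * (q 0 - a 0) = 0 ∧
      ∀ k, (a k ≤ q k ∧ q k ≤ b k) ∨ (b k ≤ q k ∧ q k ≤ a k) := by
  rw [segment_eq_image_lineMap]
  constructor
  · rintro ⟨t, ⟨ht₀, ht₁⟩, rfl⟩
    simp only [AffineMap.lineMap_apply, vsub_eq_sub, vadd_eq_add, PiLp.add_apply, PiLp.smul_apply,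
      PiLp.sub_apply, smul_eq_mul]
    refine ⟨by ring, fun k => ?_⟩
    rcases le_total (a k) (b k) with h | h
    · exact .inl ⟨by nlinarith, by nlinarith⟩
    · exact .inr ⟨by nlinarith, by nlinarith⟩
  · rintro ⟨h₀, h⟩
    have key : ∀ k, a k ≠ b k → (q k - a k) / (b k - a k) ∈ Set.Icc (0 : ℝ) 1 := by
      intro k hk
      rcases hk.lt_or_gt with hlt | hlt
      · rcases h k with ⟨h₁, h₂⟩ | ⟨h₁, h₂⟩
        · exact ⟨div_nonneg (by linarith) (by linarith), (div_le_one (by linarith)).2 (by linarith)⟩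
        · linarith
      · rcases h k with ⟨h₁, h₂⟩ | ⟨h₁, h₂⟩
        · linarith
        · exact ⟨div_nonneg_of_nonpos (by linarith) (by linarith),
            (div_le_one_of_neg (by linarith)).2 (by linarith)⟩
    by_cases hab : a = b
    · subst hab
      refine ⟨0, by simp, ?_⟩
      ext k
      rcases h k with h | h <;> simpa using le_antisymm h.1 h.2
    · obtain ⟨k, hk⟩ : ∃ k, a k ≠ b k := by
        by_contra! hcon
        exact hab (by ext k; exact hcon k)
      refine ⟨_, key k hk, ?_⟩
      have hk' : b k - a k ≠ 0 := sub_ne_zero.2 hk.symm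
      ext l
      simp only [AffineMap.lineMap_apply, vsub_eq_sub, vadd_eq_add, PiLp.add_apply,
        PiLp.smul_apply, PiLp.sub_apply, smul_eq_mul]
      rw [← eq_sub_iff_add_eq, div_mul_eq_mul_div, div_eq_iff hk']
      fin_cases k <;> fin_cases l <;> simp only [Fin.zero_eta, Fin.mk_one] at * <;> linarith

namespace Polygon

variable {n : ℕ} (P : Polygon (EuclideanSpace ℝ (Fin 2)) n)

lemma isClosed_boundary : IsClosed (P.boundary ℝ) := by
  refine isClosed_iUnion_of_finite fun i => ?_
  rw [edgeSet_eq_image_edgePath]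
  exact (isCompact_Icc.image (P.edgePath ℝ i).continuous_of_finiteDimensional).isClosed

lemma isPreconnected_boundary : IsPreconnected (P.boundary ℝ) := by
  rcases n with _ | n
  · simp [boundary, isPreconnected_empty]
  have hmem : ∀ i, P i ∈ P.edgeSet ℝ i := fun i => left_mem_affineSegment ℝ _ _
  have hmem' : ∀ i, P (finRotate (n + 1) i) ∈ P.edgeSet ℝ i := fun i =>
    right_mem_affineSegment ℝ _ _
  refine IsPreconnected.iUnion_of_chain (fun i => ?_) fun i => ?_
  · rw [edgeSet, affineSegment_eq_segment]
    exact (convex_segment _ _).isPreconnected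
  · rcases (Fin.le_last i).eq_or_lt with rfl | hi
    · exact ⟨_, hmem _, by rw [Fin.orderSucc_last]; exact hmem _⟩
    · refine ⟨P (finRotate (n + 1) i), hmem' i, ?_⟩
      convert hmem _ using 2
      obtain ⟨i, rfl⟩ := Fin.eq_castSucc_of_ne_last hi.ne
      rw [Fin.orderSucc_castSucc, finRotate_apply, Fin.coeSucc_eq_succ]

/-- Each bounded component of the complement of the boundary is attached to the boundary. -/
lemma isConnected_region (hn : 0 < n) : IsConnected P.region := by
  have hP : P ⟨0, hn⟩ ∈ P.boundary ℝ :=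
    Set.mem_iUnion.2 ⟨_, left_mem_affineSegment ℝ _ _⟩
  refine ⟨⟨_, .inl hP⟩, isPreconnected_of_forall (P ⟨0, hn⟩) fun y hy => ?_⟩
  rcases hy with hy | ⟨hy, hb⟩
  · exact ⟨_, Set.subset_union_left, hP, hy, P.isPreconnected_boundary⟩
  set C := connectedComponentIn (P.boundary ℝ)ᶜ y with hC
  have hyC : y ∈ C := mem_connectedComponentIn hy
  have hCopen : IsOpen C := P.isClosed_boundary.isOpen_compl.connectedComponentIn
  have hCconn : IsPreconnected C := isPreconnected_connectedComponentIn
  have hCuniv : C ≠ Set.univ := by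
    intro h
    rw [h] at hb
    exact NormedSpace.unbounded_univ ℝ (EuclideanSpace ℝ (Fin 2)) hb
  obtain ⟨p, hp⟩ : (frontier C).Nonempty := nonempty_frontier_iff.2 ⟨⟨y, hyC⟩, hCuniv⟩
  have hpC : IsPreconnected (insert p C) :=
    hCconn.subset_closure (Set.subset_insert _ _)
      (Set.insert_subset hp.1 subset_closure)
  have hpbd : p ∈ P.boundary ℝ := by
    by_contra hcon
    have : insert p C ⊆ C := hpC.subset_connectedComponentIn (Set.mem_insert_of_mem _ hyC)
      (Set.insert_subset hcon (connectedComponentIn_subset _ _))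
    have hpC' := this (Set.mem_insert _ _)
    exact hp.2 (hCopen.interior_eq.symm ▸ hpC')
  refine ⟨P.boundary ℝ ∪ insert p C, Set.union_subset Set.subset_union_left
    (Set.insert_subset (.inl hpbd) fun c hc => .inr ⟨connectedComponentIn_subset _ _ hc, ?_⟩),
    .inl hP, .inr (Set.mem_insert_of_mem _ hyC),
    P.isPreconnected_boundary.union p hpbd (Set.mem_insert _ _) hpC⟩
  rw [← connectedComponentIn_eq hc]
  exact hb

/-- Whether a point belongs to the region of a polygon with integral vertices depends only on the
signs of finitely many affine forms with integer coefficients at the point. The forms are those of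
the lines of the edges and of the vertical and horizontal lines through the vertices: points with
equal signs form a convex set that lies in the boundary or avoids it. -/
lemma exists_forms_region (hint : P.HasIntegerCoordinates) :
    ∃ (c : Fin n × Fin 3 → Fin 3 → ℤ) (Φ : Set (Fin n × Fin 3 → SignType)),
      ∀ q, q ∈ P.region ↔
        (fun k => SignType.sign ((c k 0 : ℝ) * q 0 + c k 1 * q 1 + c k 2)) ∈ Φ := by
  choose z hz using hint
  let c : Fin n × Fin 3 → Fin 3 → ℤ := fun k =>
    ![![1, 0, -z k.1 0], ![0, 1, -z k.1 1],
      ![-(z (finRotate n k.1) 1 - z k.1 1), z (finRotate n k.1) 0 - z k.1 0,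
        (z (finRotate n k.1) 1 - z k.1 1) * z k.1 0 -
          (z (finRotate n k.1) 0 - z k.1 0) * z k.1 1]] k.2
  let L : Fin n × Fin 3 → EuclideanSpace ℝ (Fin 2) → ℝ := fun k q =>
    (c k 0 : ℝ) * q 0 + c k 1 * q 1 + c k 2
  let σ : EuclideanSpace ℝ (Fin 2) → Fin n × Fin 3 → SignType := fun q k => SignType.sign (L k q)
  have hL0 : ∀ i q, L (i, 0) q = q 0 - P i 0 := fun i q => by simp [L, c, hz]; ring
  have hL1 : ∀ i q, L (i, 1) q = q 1 - P i 1 := fun i q => by simp [L, c, hz]; ring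
  have hL2 : ∀ i q, L (i, 2) q = (P (finRotate n i) 0 - P i 0) * (q 1 - P i 1) -
      (P (finRotate n i) 1 - P i 1) * (q 0 - P i 0) := fun i q => by simp [L, c, hz]; ring
  have hbd : ∀ q, q ∈ P.boundary ℝ ↔ ∃ i, σ q (i, 2) = 0 ∧ ∀ k : Fin 2,
      (0 ≤ σ q (i, k.castSucc) ∧ σ q (finRotate n i, k.castSucc) ≤ 0) ∨
      (0 ≤ σ q (finRotate n i, k.castSucc) ∧ σ q (i, k.castSucc) ≤ 0) := by
    intro q
    simp only [boundary, Set.mem_iUnion, edgeSet, affineSegment_eq_segment, mem_segment_plane_iff]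
    refine exists_congr fun i => ?_
    simp only [σ, sign_eq_zero_iff, hL2, sign_nonneg_iff, sign_nonpos_iff, Fin.forall_fin_two]
    simp [hL0, hL1]
  have hconv : ∀ s, Convex ℝ {q | σ q = s} := by
    intro s q hq q' hq' a b ha hb hab
    funext k
    have h₁ := convex_setOf_sign_eq (s k) (congrFun hq k) (congrFun hq' k) ha hb hab
    have h₂ : L k (a • q + b • q') = a • L k q + b • L k q' := by
      simp only [L, PiLp.add_apply, PiLp.smul_apply, smul_eq_mul]
      linear_combination (-(c k 2 : ℝ)) * hab
    change SignType.sign (L k (a • q + b • q')) = s k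
    rw [h₂]
    exact h₁
  have hsame : ∀ q q', σ q = σ q' → q ∈ P.region → q' ∈ P.region := by
    rintro q q' hσ (hq | ⟨hq, hb⟩)
    · refine .inl ?_
      rw [hbd, ← hσ, ← hbd]
      exact hq
    · have hsub : {p | σ p = σ q} ⊆ (P.boundary ℝ)ᶜ := by
        intro p hp hpbd
        have hp' : σ p = σ q := hp
        rw [hbd, hp', ← hbd] at hpbd
        exact hq hpbd
      refine .inr ⟨hsub hσ.symm, ?_⟩
      have hmem : q' ∈ connectedComponentIn (P.boundary ℝ)ᶜ q :=
        (hconv (σ q)).isPreconnected.subset_connectedComponentIn rfl hsub hσ.symm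
      rw [← connectedComponentIn_eq hmem]
      exact hb
  exact ⟨c, {s | ∃ q ∈ P.region, σ q = s}, fun q =>
    ⟨fun hq => ⟨q, hq, rfl⟩, fun ⟨q', hq', h⟩ => hsame q' q h hq'⟩⟩

end Polygon

lemma mem_image_add_left_iff_sub_mem {E : Type*} [AddCommGroup E] (K : Set E) (t p : E) :
    p ∈ (fun x => t + x) '' K ↔ p - t ∈ K := by
  rw [Set.image_add_left, Set.mem_preimage, neg_add_eq_sub]

/-! ### Signs of linear forms of binary numbers by a finite automaton -/

/-- The natural number whose binary digits, most significant first, are the first `T` values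
of `b`. -/
def bitsValue (b : ℕ → Bool) : ℕ → ℕ
  | 0 => 0
  | T + 1 => 2 * bitsValue b T + (b T).toNat

lemma bitsValue_testBit (z L : ℕ) (hz : z < 2 ^ L) :
    bitsValue (fun j => z.testBit (L - 1 - j)) L = z := by
  have key : ∀ j ≤ L, bitsValue (fun j => z.testBit (L - 1 - j)) j = z / 2 ^ (L - j) := by
    intro j hj
    induction j with
    | zero => simp [bitsValue, Nat.div_eq_of_lt hz]
    | succ j ih =>
      rw [bitsValue, ih (by omega), Nat.toNat_testBit, show L - j = L - (j + 1) + 1 by omega,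
        show L - 1 - j = L - (j + 1) by omega, pow_succ, ← Nat.div_div_eq_div_mul]
      exact Nat.div_add_mod _ 2
  simpa using key L le_rfl

section SignAutomaton

variable {K : Type} (u w : K → Fin 3 → ℤ) (B : ℕ)

/-- The value of the linear form with the coefficients `u k` and `w k`. -/
def formValue (k : K) (x y : Fin 3 → ℤ) : ℤ := ∑ i, u k i * x i + ∑ i, w k i * y i

/-- The truncation of an integer to the interval from `-B` to `B`. -/
def clamp (a : ℤ) : Set.Icc (-B : ℤ) B := Set.projIcc (-B : ℤ) B (by omega) a

lemma sign_clamp (hB : 1 ≤ B) (a : ℤ) : SignType.sign (clamp B a : ℤ) = SignType.sign a := by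
  rw [clamp, Set.coe_projIcc]
  rcases lt_trichotomy a 0 with h | rfl | h
  · rw [sign_neg h, sign_neg]
    omega
  · congr 1
    omega
  · rw [sign_pos h, sign_pos]
    omega

/-- A carry beyond the bound `B` never returns, so doubling may truncate first. -/
lemma clamp_two_mul_add (a f : ℤ) (hf : |f| ≤ B) :
    clamp B (2 * (clamp B a : ℤ) + f) = clamp B (2 * a + f) := by
  rw [abs_le] at hf
  refine Subtype.ext ?_
  simp only [clamp, Set.coe_projIcc]
  omega

/-- The automaton doubles the truncated value of each form and adds the contribution of the next
digits. -/
def signStep (q : K → Set.Icc (-B : ℤ) B) (ξ η : Fin 3 → Bool) : K → Set.Icc (-B : ℤ) B :=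
  fun k => clamp B (2 * (q k : ℤ) +
    formValue u w k (fun i => ((ξ i).toNat : ℤ)) fun i => ((η i).toNat : ℤ))

/-- The state of the automaton holds the truncated values of the forms at the prefixes. -/
lemma runStreams_signStep (hB : ∀ k, ∑ i, |u k i| + ∑ i, |w k i| ≤ B) (ξ η : ℕ → Fin 3 → Bool)
    (T : ℕ) (k : K) :
    runStreams (fun _ => clamp B 0) (signStep u w B) ξ η T k =
      clamp B (formValue u w k (fun i => (bitsValue (fun j => ξ j i) T : ℤ))
        fun i => (bitsValue (fun j => η j i) T : ℤ)) := by
  induction T with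
  | zero => simp [runStreams, bitsValue, formValue]
  | succ T ih =>
    have hbit : ∀ (c : ℤ) (b : Bool), |c * (b.toNat : ℤ)| ≤ |c| := by
      rintro c (_ | _) <;> simp
    rw [runStreams, signStep, ih, clamp_two_mul_add]
    · congr 1
      simp only [formValue, bitsValue, Nat.cast_add, Nat.cast_mul, Nat.cast_ofNat, mul_add,
        Finset.sum_add_distrib, Finset.mul_sum, mul_left_comm _ (2 : ℤ)]
      ring
    · refine (abs_add_le _ _).trans ((add_le_add ((Finset.abs_sum_le_sum_abs _ _).trans
        (Finset.sum_le_sum fun i _ => hbit _ _)) ((Finset.abs_sum_le_sum_abs _ _).trans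
        (Finset.sum_le_sum fun i _ => hbit _ _))).trans (hB k))

lemma sign_runStreams_signStep (hB1 : 1 ≤ B) (hB : ∀ k, ∑ i, |u k i| + ∑ i, |w k i| ≤ B)
    (ξ η : ℕ → Fin 3 → Bool) (T : ℕ) (k : K) :
    SignType.sign (runStreams (fun _ => clamp B 0) (signStep u w B) ξ η T k : ℤ) =
      SignType.sign (formValue u w k (fun i => (bitsValue (fun j => ξ j i) T : ℤ))
        fun i => (bitsValue (fun j => η j i) T : ℤ)) := by
  rw [runStreams_signStep u w B hB, sign_clamp B hB1]

end SignAutomaton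

/-! ### Recognition of translates of a set that is described by signs -/

namespace Hypergraph

/-- As the sets of a representation depend on the hyperedge only, equal rows need not be given
distinct translates, but any translate of one of them will do. -/
lemma isRepresentableBy_translates_iff {E : Type*} [AddCommGroup E] [TopologicalSpace E]
    [ContinuousAdd E] {n : ℕ} (rows : List (Fin n → Bool)) {K : Set E} (hK : IsConnected K) :
    (ofIncidence rows).IsRepresentableBy (translates K) ↔
      ∃ (p : Fin n → E) (t : Fin rows.length → E), ∀ v e, p v - t e ∈ K ↔ rows[e] v = true := by
  classical
  constructor
  · rintro ⟨p, s, hs, hrep⟩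
    have hmem : ∀ e : Fin rows.length, {v | rows[e] v = true} ∈ (ofIncidence rows).edgeSet :=
      fun e => ⟨rows[e], List.getElem_mem _, rfl⟩
    choose t ht using fun e => hs _ (hmem e)
    refine ⟨p, t, fun v e => ?_⟩
    have := (hrep _ (hmem e)).2 v (Set.mem_univ v)
    rw [← ht e, mem_image_add_left_iff_sub_mem] at this
    exact this
  · rintro ⟨p, t, h⟩
    have hshift : ∀ S ∈ (ofIncidence rows).edgeSet, ∃ a : E, ∀ v, p v - a ∈ K ↔ v ∈ S := by
      rintro S ⟨r, hr, rfl⟩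
      obtain ⟨e, he, rfl⟩ := List.getElem_of_mem hr
      exact ⟨t ⟨e, he⟩, fun v => h v ⟨e, he⟩⟩
    choose! a ha using hshift
    refine ⟨p, fun S => (fun x => a S + x) '' K, fun S _ => ⟨_, rfl⟩, fun S hS =>
      ⟨hK.image _ (by fun_prop), fun v _ => ?_⟩⟩
    rw [mem_image_add_left_iff_sub_mem, ha S hS]

end Hypergraph

section Recognition

open Hypergraph

variable {K : Type} (c : K → Fin 3 → ℤ)

/-- The coefficients at `(x, y, d)` of a vertex in the forms that the automaton evaluates: the forms
`c k` at the difference of a vertex and a hyperedge, with common denominator `d`, then the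
difference of the two copies of `d`, then `d`. -/
def vertexCoeff : K ⊕ Bool → Fin 3 → ℤ
  | .inl k => c k
  | .inr _ => ![0, 0, 1]

/-- The coefficients at `(x, y, d)` of a hyperedge in the forms that the automaton evaluates. -/
def edgeCoeff : K ⊕ Bool → Fin 3 → ℤ
  | .inl k => ![-c k 0, -c k 1, 0]
  | .inr false => ![0, 0, -1]
  | .inr true => 0

/-- Points and translation vectors can be replaced by points with a small common denominator `d`
and small numerators `X` and `Y`, without a change of the signs of the forms `c k` at the
differences. -/
lemma exists_rational_solution {n m : ℕ} [Finite K] (B : ℕ) (hB1 : 1 ≤ B)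
    (hB : ∀ k i, |c k i| ≤ B)
    (p : Fin n → EuclideanSpace ℝ (Fin 2)) (t : Fin m → EuclideanSpace ℝ (Fin 2)) :
    ∃ (X : Fin n → Fin 2 → ℕ) (Y : Fin m → Fin 2 → ℕ) (d : ℕ), 0 < d ∧
      (∀ v k, X v k < 2 ^ ((2 * (n + m) + 1) * B * (2 * (n + m) + 1))) ∧
      (∀ e k, Y e k < 2 ^ ((2 * (n + m) + 1) * B * (2 * (n + m) + 1))) ∧
      d < 2 ^ ((2 * (n + m) + 1) * B * (2 * (n + m) + 1)) ∧
      ∀ v e k, SignType.sign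
          (c k 0 * ((X v 0 : ℤ) - Y e 0) + c k 1 * ((X v 1 : ℤ) - Y e 1) + c k 2 * d) =
        SignType.sign ((c k 0 : ℝ) * (p v - t e) 0 + c k 1 * (p v - t e) 1 + c k 2) := by
  classical
  let ι := Option ((Fin n ⊕ Fin m) × Fin 2)
  let r : Option (Fin n × Fin m × K) → ι → ℤ := fun i j =>
    match i, j with
    | none, none => 1
    | none, some _ => 0
    | some (_, _, k), none => c k 2
    | some (v, _, k), some (.inl v', l) => if v' = v then c k l.castSucc else 0
    | some (_, e, k), some (.inr e', l) => if e' = e then -c k l.castSucc else 0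
  -- a translation that makes all coordinates nonnegative
  obtain ⟨μ, hμp, hμt⟩ : ∃ μ : ℝ, (∀ v k, 0 ≤ p v k + μ) ∧ ∀ e k, 0 ≤ t e k + μ := by
    obtain ⟨a, ha⟩ := (Set.finite_range fun vk : Fin n × Fin 2 => -p vk.1 vk.2).bddAbove
    obtain ⟨b, hb⟩ := (Set.finite_range fun ek : Fin m × Fin 2 => -t ek.1 ek.2).bddAbove
    refine ⟨max a b, fun v k => ?_, fun e k => ?_⟩
    · have := ha ⟨(v, k), rfl⟩
      have := le_max_left a b
      simp only at *
      linarith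
    · have := hb ⟨(e, k), rfl⟩
      have := le_max_right a b
      simp only at *
      linarith
  let x : ι → ℝ
    | none => 1
    | some (.inl v, k) => p v k + μ
    | some (.inr e, k) => t e k + μ
  have hsum : ∀ {R : Type} [CommRing R] (f : ℤ →+* R) (v e k) (y : ι → R),
      ∑ j, f (r (some (v, e, k)) j) * y j =
        f (c k 0) * (y (some (.inl v, 0)) - y (some (.inr e, 0))) +
        f (c k 1) * (y (some (.inl v, 1)) - y (some (.inr e, 1))) + f (c k 2) * y none := by
    intro R _ f v e k y
    simp only [ι, r, Fintype.sum_option, Fintype.sum_prod_type, Fintype.sum_sum_type,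
      Fin.sum_univ_two]
    simp only [apply_ite f, map_zero, ite_mul, zero_mul, Finset.sum_add_distrib,
      Finset.sum_ite_eq', Finset.mem_univ, if_true, map_neg]
    simp only [Fin.castSucc_zero, Fin.castSucc_one]
    ring
  obtain ⟨z, hz, hsign⟩ := exists_nat_sign_eq r B hB1 (by
      rintro (_ | ⟨v, e, k⟩) (_ | ⟨v' | e', l⟩) <;> simp only [r]
      · simpa using hB1
      · simp
      · simp
      · exact hB k 2
      · split_ifs
        · exact hB k _
        · simp
      · split_ifs
        · simpa using hB k _
        · simp) x (by
      rintro (_ | ⟨v | e, k⟩)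
      · exact zero_le_one
      · exact hμp v k
      · exact hμt e k)
  have hcard : Fintype.card ι = 2 * (n + m) + 1 := by
    simp [ι]
    ring
  have hlt : ∀ j, z j < 2 ^ ((2 * (n + m) + 1) * B * (2 * (n + m) + 1)) := by
    intro j
    have h₁ := hz j
    rw [hcard] at h₁
    have hN : 2 * (n + m) + 1 ≠ 0 := by omega
    generalize 2 * (n + m) + 1 = N at h₁ hN ⊢
    calc z j ≤ N.factorial * B ^ N := h₁
      _ ≤ N ^ N * B ^ N := Nat.mul_le_mul_right _ (Nat.factorial_le_pow N)
      _ = (N * B) ^ N := (mul_pow _ _ _).symm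
      _ < (2 ^ (N * B)) ^ N := Nat.pow_lt_pow_left Nat.lt_two_pow_self hN
      _ = 2 ^ (N * B * N) := (pow_mul _ _ _).symm
  refine ⟨fun v k => z (some (.inl v, k)), fun e k => z (some (.inr e, k)), z none, ?_,
    fun v k => hlt _, fun e k => hlt _, hlt _, fun v e k => ?_⟩
  · have h := hsign none
    simp only [ι, r, Fintype.sum_option] at h
    simp only [x, zero_mul, Finset.sum_const_zero, one_mul, add_zero, Int.cast_one, Int.cast_zero,
      sign_one, sign_eq_one_iff] at h
    exact_mod_cast h
  · have h := hsign (some (v, e, k))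
    have h₁ := hsum (RingHom.id ℤ) v e k fun j => (z j : ℤ)
    have h₂ := hsum (Int.castRingHom ℝ) v e k x
    simp only [eq_intCast, Int.cast_id] at h₁ h₂
    rw [h₁, h₂] at h
    rw [h]
    congr 1
    simp only [x, PiLp.sub_apply]
    ring

/-- The recognition problem of the translates of a connected set in the plane is in NP if
membership in the set depends only on the signs of finitely many integer affine forms. -/
theorem inNP_recognition_translates [Finite K] {R : Set (EuclideanSpace ℝ (Fin 2))}
    (hR : IsConnected R) (Φ : Set (K → SignType))
    (hΦ : ∀ q, q ∈ R ↔
      (fun k => SignType.sign ((c k 0 : ℝ) * q 0 + c k 1 * q 1 + c k 2)) ∈ Φ) :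
    InNP (Recognition (translates R)) := by
  classical
  obtain ⟨B, hB1, hcB, hB⟩ : ∃ B : ℕ, 1 ≤ B ∧ (∀ k i, |c k i| ≤ B) ∧
      ∀ k, ∑ i, |vertexCoeff c k i| + ∑ i, |edgeCoeff c k i| ≤ B := by
    obtain ⟨a, ha⟩ := (Set.finite_range fun k =>
      ∑ i, |vertexCoeff c k i| + ∑ i, |edgeCoeff c k i|).bddAbove
    have ha' : ∀ k, ∑ i, |vertexCoeff c k i| + ∑ i, |edgeCoeff c k i| ≤ a := fun k => ha ⟨k, rfl⟩
    refine ⟨a.toNat + 1, by omega, fun k i => ?_, fun k => ?_⟩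
    · have h₁ := ha' (.inl k)
      have h₂ : |c k i| ≤ ∑ i, |c k i| :=
        Finset.single_le_sum (fun i _ => abs_nonneg (c k i)) (Finset.mem_univ i)
      have h₃ : 0 ≤ ∑ i, |edgeCoeff c (.inl k) i| := Finset.sum_nonneg fun i _ => abs_nonneg _
      simp only [vertexCoeff] at h₁
      omega
    · have := ha' k
      omega
  let good : (K ⊕ Bool → Set.Icc (-B : ℤ) B) → Bool → Prop := fun q b =>
    SignType.sign (q (.inr false) : ℤ) = 0 ∧ SignType.sign (q (.inr true) : ℤ) = 1 ∧
      ((fun k => SignType.sign (q (.inl k) : ℤ)) ∈ Φ ↔ b = true)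
  have hgood : ∀ (ξ η : ℕ → Fin 3 → Bool) (T : ℕ) (b : Bool),
      good (runStreams (fun _ => clamp B 0) (signStep (vertexCoeff c) (edgeCoeff c) B) ξ η T) b ↔
        bitsValue (fun j => ξ j 2) T = bitsValue (fun j => η j 2) T ∧
        0 < bitsValue (fun j => ξ j 2) T ∧
        ((fun k => SignType.sign (c k 0 *
            ((bitsValue (fun j => ξ j 0) T : ℤ) - bitsValue (fun j => η j 0) T) +
          c k 1 * ((bitsValue (fun j => ξ j 1) T : ℤ) - bitsValue (fun j => η j 1) T) +
          c k 2 * bitsValue (fun j => ξ j 2) T)) ∈ Φ ↔ b = true) := by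
    intro ξ η T b
    simp only [good, sign_runStreams_signStep _ _ B hB1 hB]
    refine and_congr ?_ (and_congr ?_ ?_)
    · simp only [formValue, vertexCoeff, edgeCoeff, Fin.sum_univ_three, sign_eq_zero_iff]
      simp
      omega
    · simp only [formValue, vertexCoeff, edgeCoeff, Fin.sum_univ_three, sign_eq_one_iff]
      simp
    · refine Eq.to_iff (congrArg (fun s => (s ∈ Φ ↔ b = true)) (funext fun k => ?_))
      simp only [formValue, vertexCoeff, edgeCoeff, Fin.sum_univ_three]
      congr 1
      simp
      ring
  -- The polynomial bounds the number of digits: there are `2 * (n + m) + 1` unknowns, and `n + m`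
  -- is at most the length of the input.
  refine inNP_of_streams (A := Fin 3 → Bool) (fun _ => clamp B 0)
    (signStep (vertexCoeff c) (edgeCoeff c) B) good _
    ((2 * Polynomial.X + 1) * Polynomial.C B * (2 * Polynomial.X + 1)) ?_ ?_
  · intro n rows T ξ η h
    refine ⟨n, rows, rfl, (isRepresentableBy_translates_iff rows hR).2 ⟨
      fun v => !₂[(bitsValue (fun j => ξ v j 0) T : ℝ) / bitsValue (fun j => ξ v j 2) T,
        (bitsValue (fun j => ξ v j 1) T : ℝ) / bitsValue (fun j => ξ v j 2) T],
      fun e => !₂[(bitsValue (fun j => η e j 0) T : ℝ) / bitsValue (fun j => η e j 2) T,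
        (bitsValue (fun j => η e j 1) T : ℝ) / bitsValue (fun j => η e j 2) T],
      fun v e => ?_⟩⟩
    obtain ⟨h₁, h₂, h₃⟩ := (hgood _ _ _ _).1 (h v e)
    rw [← h₃, hΦ]
    refine Eq.to_iff (congrArg (· ∈ Φ) (funext fun k => ?_))
    have hd : (0 : ℝ) < bitsValue (fun j => ξ v j 2) T := by exact_mod_cast h₂
    rw [← sign_intCast (α := ℝ), ← mul_one (SignType.sign _), ← sign_pos hd, ← sign_mul]
    simp only [PiLp.sub_apply, ← h₁]
    congr 1
    push_cast
    field_simp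
  · rintro x ⟨n, rows, rfl, hrep⟩
    obtain ⟨p, t, hpt⟩ := (isRepresentableBy_translates_iff rows hR).1 hrep
    obtain ⟨X, Y, d, hd, hX, hY, hdL, hsign⟩ := exists_rational_solution c B hB1 hcB p t
    set L := (2 * (n + rows.length) + 1) * B * (2 * (n + rows.length) + 1) with hL
    let digits (a : Fin 3 → ℕ) (j : ℕ) (i : Fin 3) : Bool := (a i).testBit (L - 1 - j)
    refine ⟨n, rows, L,
      fun v => digits (if hv : v < n then ![X ⟨v, hv⟩ 0, X ⟨v, hv⟩ 1, d] else 0),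
      fun e => digits (if he : e < rows.length then ![Y ⟨e, he⟩ 0, Y ⟨e, he⟩ 1, d] else 0),
      rfl, Nat.mul_pos (Nat.mul_pos (by omega) hB1) (by omega), ?_, fun v e => ?_⟩
    · have hlen := length_encodeIncidence rows
      have h₁ : n + rows.length ≤ (encodeIncidence rows).length := by nlinarith
      simp only [Polynomial.eval_mul, Polynomial.eval_add, Polynomial.eval_X, Polynomial.eval_one,
        Polynomial.eval_C, Polynomial.eval_ofNat]
      have h₂ : 2 * (n + rows.length) + 1 ≤ 2 * (encodeIncidence rows).length + 1 := by omega
      exact Nat.mul_le_mul (Nat.mul_le_mul_right _ h₂) h₂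
    · rw [hgood]
      simp only [digits, Fin.is_lt, dite_true, Fin.eta, Matrix.cons_val_zero, Matrix.cons_val_one, Matrix.cons_val]
      rw [bitsValue_testBit _ _ hdL, bitsValue_testBit _ _ (hX _ _), bitsValue_testBit _ _ (hX _ _),
        bitsValue_testBit _ _ (hY _ _), bitsValue_testBit _ _ (hY _ _)]
      refine ⟨trivial, hd, ?_⟩
      rw [← hpt v e, hΦ]
      exact Eq.to_iff (congrArg (· ∈ Φ) (funext fun k => hsign v e k))

end Recognition

theorem theorem3 (n : ℕ) (P : Polygon (EuclideanSpace ℝ (Fin 2)) n)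
    (hsimple : P.IsSimple) (hint : P.HasIntegerCoordinates) :
    InNP (Recognition (translates P.region)) := by
  obtain ⟨c, Φ, hΦ⟩ := P.exists_forms_region hint
  exact inNP_recognition_translates c (P.isConnected_region (by have := hsimple.1; omega)) Φ hΦ
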